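/- **Setting.** Let $\Delta\subset\mathbb R^n$ be convex and compact, $U\supseteq\Delta$ open, $f:\mathbb R^n\times\mathbb R^d\to\mathbb R$ the objective of the minimax problem $\min_{\delta\in\Delta}\max_{\theta\in\mathbb R^d} f(\delta,\theta)$ (in the application, the meta-RL training performance under the attack $\delta$), and $\Phi(\delta)=\max_\theta f(\delta,\theta)$. Assume: 1. (Minimax RSI) for all $\delta\in U$ there is a maximizer $\theta^*(\delta)$ of $f(\delta,\cdot)$ with $\langle\nabla_\theta f(\delta,\theta),\theta^*(\delta)-\theta\rangle\ge\mu\|\theta^*(\delta)-\theta\|^2$ for all $\theta\in\mathbb R^d$, where $0<\mu\le 1$; 2. (Lipschitz gradients) $f$ is $C^1$ on $U\times\mathbb R^d$; for $\delta,\delta_i\in U$ and all $\theta,\theta_i$: $\|\nabla_\delta f(\delta_1,\theta)-\nabla_\delta f(\delta_2,\theta)\|\le L_{11}\|\delta_1-\delta_2\|$, $\|\nabla_\theta f(\delta,\theta_1)-\nabla_\theta f(\delta,\theta_2)\|\le L_{22}\|\theta_1-\theta_2\|$, $\|\nabla_\delta f(\delta,\theta_1)-\nabla_\delta f(\delta,\theta_2)\|\le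 L_{12}\|\theta_1-\theta_2\|$, $\|\nabla_\theta f(\delta_1,\theta)-\nabla_\theta f(\delta_2,\theta)\|\le L_{12}\|\delta_1-\delta_2\|$, with $L_{11},L_{12}\ge 0$, $L_{22}>0$ and $L:=L_{11}+L_{12}^2/(2\mu)>0$; 3. (Stochastic gradients) for $\delta\in\Delta$, $\theta\in\mathbb R^d$ and a random sample $\xi$ (a batch of size $M\ge1$) whose law $K(\delta,\theta)$ may depend on $(\delta,\theta)$, $\mathbb E[\hat\nabla f(\delta,\theta;\xi)]=\nabla f(\delta,\theta)$ and $\mathbb E\|\hat\nabla f(\delta,\theta;\xi)-\nabla f(\delta,\theta)\|^2\le\sigma^2/M$. Put $\Phi_\infty=\max\{\max_{\delta\in\Delta}\|\nabla\Phi(\delta)\|,1\}$, $\bar L=\max\{L_{12},L_{22},1,\Phi_\infty\}$, $\kappa=2\bar L/\mu^2$. *Persistent Attack* starts at deterministic $\delta_0\in\Delta$, $\theta_0\in\mathbb R^d$ and, for $t=0,\dots,N-1$, draws $\xi_t$ with law $K(\delta_t,\theta_t)$ given $(\delta_t,\theta_t)$ and sets $$\theta_{t+1}=\theta_t+\eta_1\hat\nabla_\theta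 f(\delta_t,\theta_t;\xi_t),\qquad \delta_{t+1}=\Pi_\Delta\big(\delta_t-\eta_2\hat\nabla_\delta f(\delta_t,\theta_t;\xi_t)\big),$$ where $\Pi_\Delta$ is the Euclidean projection. Let $D_\Phi=\Phi(\delta_0)-\min_{\Delta}\Phi$, and let $D\ge1$ be a bound for both the diameter of $\Delta$ and $\|\theta_0-\theta^*(\delta_0)\|$. A pair $(\delta,\theta)$ is an $\varepsilon$-FOSP if $\langle\nabla_\delta f(\delta,\theta),\delta'-\delta\rangle\ge-\varepsilon$ for all $\delta'\in\Delta$ with $\|\delta'-\delta\|\le1$ and $\langle\nabla_\theta f(\delta,\theta),\theta'-\theta\rangle\le\varepsilon$ for all $\theta'\in\mathbb R^d$ with $\|\theta'-\theta\|\le1$. Let $r(\delta,\theta)$ be the smallest $\varepsilon$ for which $(\delta,\theta)$ is an $\varepsilon$-FOSP. **Theorem.** There are constants $C_N,C_M>0$, depending only on $\mu,L_{11},L_{12},L_{22},\Phi_\infty$, such that for every such problem and every $\varepsilon\in(0,1)$ the following holds. Let $\eta_1=\mu/L_{22}$ and $\eta_2=\min\{1/(32L),\,1/(8\kappa^2\bar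 L)\}$. If $$N\ge C_N\,\frac{(8\kappa^2+32)\bar L D_\Phi+\kappa D^2\bar L^2}{\varepsilon^2},\qquad M\ge C_M\,\frac{\sigma^2\kappa}{\varepsilon^2},$$ then there is an index $t<N$ for which the iterate $(\delta_t,\theta_t)$ of Persistent Attack is an $\varepsilon$-FOSP in expectation: $\mathbb E[r(\delta_t,\theta_t)]\le\varepsilon$ (and this expectation exists). -/

import Mathlib

open MeasureTheory ProbabilityTheory

noncomputable section

/-- `ℝᵏ` with the Euclidean norm. -/
abbrev Euc (k : ℕ) : Type := EuclideanSpace ℝ (Fin k)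

/-- Partial gradient of `f (δ, θ)` in the attacker's variable `δ`. -/
def gradDelta {n d : ℕ} (f : Euc n → Euc d → ℝ) (δ : Euc n) (θ : Euc d) : Euc n :=
  gradient (fun x => f x θ) δ

/-- Partial gradient of `f (δ, θ)` in the learner's variable `θ`. -/
def gradTheta {n d : ℕ} (f : Euc n → Euc d → ℝ) (δ : Euc n) (θ : Euc d) : Euc d :=
  gradient (fun y => f δ y) θ

/-- The value function `Φ(δ) = max_θ f(δ, θ)`. -/
def valueFn {n d : ℕ} (f : Euc n → Euc d → ℝ) (δ : Euc n) : ℝ :=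
  ⨆ θ : Euc d, f δ θ

/-- Minimax restricted secant inequality with constant `μ` for all `δ ∈ U`, where
`θstar δ` is the maximizer of `f δ`. -/
structure MinimaxRSI {n d : ℕ} (f : Euc n → Euc d → ℝ) (U : Set (Euc n)) (μ : ℝ)
    (θstar : Euc n → Euc d) : Prop where
  isMax : ∀ δ ∈ U, ∀ θ, f δ θ ≤ f δ (θstar δ)
  rsi : ∀ δ ∈ U, ∀ θ,
    μ * ‖θstar δ - θ‖ ^ 2 ≤ inner ℝ (gradTheta f δ θ) (θstar δ - θ)

/-- `f` is continuously differentiable on `U × ℝᵈ`, with Lipschitz partial gradients. -/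
structure LipschitzGradients {n d : ℕ} (f : Euc n → Euc d → ℝ) (U : Set (Euc n))
    (L11 L12 L22 : ℝ) : Prop where
  contDiff : ContDiffOn ℝ 1 (fun p : Euc n × Euc d => f p.1 p.2) (U ×ˢ Set.univ)
  lip11 : ∀ δ₁ ∈ U, ∀ δ₂ ∈ U, ∀ θ,
    ‖gradDelta f δ₁ θ - gradDelta f δ₂ θ‖ ≤ L11 * ‖δ₁ - δ₂‖
  lip22 : ∀ δ ∈ U, ∀ θ₁ θ₂,
    ‖gradTheta f δ θ₁ - gradTheta f δ θ₂‖ ≤ L22 * ‖θ₁ - θ₂‖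
  lip12 : ∀ δ ∈ U, ∀ θ₁ θ₂,
    ‖gradDelta f δ θ₁ - gradDelta f δ θ₂‖ ≤ L12 * ‖θ₁ - θ₂‖
  lip21 : ∀ δ₁ ∈ U, ∀ δ₂ ∈ U, ∀ θ,
    ‖gradTheta f δ₁ θ - gradTheta f δ₂ θ‖ ≤ L12 * ‖δ₁ - δ₂‖

/-- Unbiased stochastic gradients `(gδ, gθ)` with variance at most `σ² / M`. The sample `ξ`
(the batch of tasks and trajectories, of batch size `M`) is drawn from `K (δ, θ)`: its law
may depend on the point at which the gradient is estimated. -/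
structure StochasticGradients {n d : ℕ} {Ξ : Type*} [MeasurableSpace Ξ]
    (f : Euc n → Euc d → ℝ) (Δ : Set (Euc n)) (K : Kernel (Euc n × Euc d) Ξ)
    (gδ : Euc n → Euc d → Ξ → Euc n) (gθ : Euc n → Euc d → Ξ → Euc d)
    (σ : ℝ) (M : ℕ) : Prop where
  measurable_gδ : Measurable (fun p : (Euc n × Euc d) × Ξ => gδ p.1.1 p.1.2 p.2)
  measurable_gθ : Measurable (fun p : (Euc n × Euc d) × Ξ => gθ p.1.1 p.1.2 p.2)
  integrable_gδ : ∀ δ ∈ Δ, ∀ θ, Integrable (gδ δ θ) (K (δ, θ))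
  integrable_gθ : ∀ δ ∈ Δ, ∀ θ, Integrable (gθ δ θ) (K (δ, θ))
  unbiased_gδ : ∀ δ ∈ Δ, ∀ θ, ∫ ξ, gδ δ θ ξ ∂(K (δ, θ)) = gradDelta f δ θ
  unbiased_gθ : ∀ δ ∈ Δ, ∀ θ, ∫ ξ, gθ δ θ ξ ∂(K (δ, θ)) = gradTheta f δ θ
  integrable_sq : ∀ δ ∈ Δ, ∀ θ, Integrable
    (fun ξ => ‖gδ δ θ ξ - gradDelta f δ θ‖ ^ 2 + ‖gθ δ θ ξ - gradTheta f δ θ‖ ^ 2) (K (δ, θ))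
  variance_le : ∀ δ ∈ Δ, ∀ θ,
    ∫ ξ, (‖gδ δ θ ξ - gradDelta f δ θ‖ ^ 2 + ‖gθ δ θ ξ - gradTheta f δ θ‖ ^ 2) ∂(K (δ, θ))
      ≤ σ ^ 2 / M

/-- `p` is the Euclidean projection of `x` onto `Δ`. -/
def IsProjection {n : ℕ} (Δ : Set (Euc n)) (x p : Euc n) : Prop :=
  p ∈ Δ ∧ ∀ q ∈ Δ, ‖x - p‖ ≤ ‖x - q‖

/-- A run of `N` iterations of Persistent Attack on the probability space `(Ω, P)`:
at every iteration a sample `ξ t` is drawn from `K` at the current iterate, and both players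
are updated from it, the learner by gradient ascent with step size `η₁` and the
attacker by projected gradient descent with step size `η₂`. -/
structure IsPersistentAttack {n d : ℕ} {Ξ Ω : Type*} [MeasurableSpace Ξ] [MeasurableSpace Ω]
    (P : Measure Ω) (Δ : Set (Euc n)) (K : Kernel (Euc n × Euc d) Ξ)
    (gδ : Euc n → Euc d → Ξ → Euc n) (gθ : Euc n → Euc d → Ξ → Euc d)
    (η₁ η₂ : ℝ) (δ₀ : Euc n) (θ₀ : Euc d) (N : ℕ)
    (ξ : ℕ → Ω → Ξ) (δ : ℕ → Ω → Euc n) (θ : ℕ → Ω → Euc d) : Prop where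
  init_δ : ∀ ω, δ 0 ω = δ₀
  init_θ : ∀ ω, θ 0 ω = θ₀
  measurable_ξ : ∀ t < N, Measurable (ξ t)
  measurable_δ : ∀ t ≤ N, Measurable (δ t)
  measurable_θ : ∀ t ≤ N, Measurable (θ t)
  /-- Given the current iterate `(δ t, θ t)`, the sample `ξ t` has law `K (δ t, θ t)`. -/
  law : ∀ t < N, P.map (fun ω => ((δ t ω, θ t ω), ξ t ω))
    = (P.map (fun ω => (δ t ω, θ t ω))) ⊗ₘ K
  step_θ : ∀ t < N, ∀ ω,
    θ (t + 1) ω = θ t ω + η₁ • gθ (δ t ω) (θ t ω) (ξ t ω)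
  step_δ : ∀ t < N, ∀ ω,
    IsProjection Δ (δ t ω - η₂ • gδ (δ t ω) (θ t ω) (ξ t ω)) (δ (t + 1) ω)

/-- `(δ, θ)` is an `ε`-first-order stationary point of `min_{δ ∈ Δ} max_θ f(δ, θ)`. -/
def IsFOSP {n d : ℕ} (f : Euc n → Euc d → ℝ) (Δ : Set (Euc n)) (ε : ℝ)
    (δ : Euc n) (θ : Euc d) : Prop :=
  (∀ δ' ∈ Δ, ‖δ' - δ‖ ≤ 1 → -ε ≤ inner ℝ (gradDelta f δ θ) (δ' - δ)) ∧
  (∀ θ' : Euc d, ‖θ' - θ‖ ≤ 1 → inner ℝ (gradTheta f δ θ) (θ' - θ) ≤ ε)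

/-- The smallest `ε` for which `(δ, θ)` is an `ε`-FOSP. -/
def fospResidual {n d : ℕ} (f : Euc n → Euc d → ℝ) (Δ : Set (Euc n))
    (δ : Euc n) (θ : Euc d) : ℝ :=
  sInf {ε : ℝ | IsFOSP f Δ ε δ θ}

theorem isFOSP_iff_fospResidual_le {n d : ℕ} (f : Euc n → Euc d → ℝ) (Δ : Set (Euc n))
    (ε : ℝ) (δ : Euc n) (θ : Euc d) :
    IsFOSP f Δ ε δ θ ↔ fospResidual f Δ δ θ ≤ ε := by
  have hbdd : BddBelow {ε : ℝ | IsFOSP f Δ ε δ θ} := by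
    refine ⟨0, fun r hr => ?_⟩
    have := hr.2 θ (by simp)
    simpa using this
  have hne : {ε : ℝ | IsFOSP f Δ ε δ θ}.Nonempty := by
    refine ⟨max ‖gradDelta f δ θ‖ ‖gradTheta f δ θ‖, fun δ' _ h => ?_, fun θ' h => ?_⟩
    · have h1 := abs_real_inner_le_norm (gradDelta f δ θ) (δ' - δ)
      have h2 : ‖gradDelta f δ θ‖ * ‖δ' - δ‖ ≤ ‖gradDelta f δ θ‖ :=
        mul_le_of_le_one_right (norm_nonneg _) h
      have h3 := le_max_left ‖gradDelta f δ θ‖ ‖gradTheta f δ θ‖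
      have h4 := neg_abs_le (inner ℝ (gradDelta f δ θ) (δ' - δ))
      linarith
    · have h1 := real_inner_le_norm (gradTheta f δ θ) (θ' - θ)
      have h2 : ‖gradTheta f δ θ‖ * ‖θ' - θ‖ ≤ ‖gradTheta f δ θ‖ :=
        mul_le_of_le_one_right (norm_nonneg _) h
      have h3 := le_max_right ‖gradDelta f δ θ‖ ‖gradTheta f δ θ‖
      linarith
  constructor
  · exact fun h => csInf_le hbdd h
  · intro h
    refine ⟨fun δ' hδ' h1 => ?_, fun θ' h1 => ?_⟩
    · have : -(inner ℝ (gradDelta f δ θ) (δ' - δ)) ≤ fospResidual f Δ δ θ :=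
        le_csInf hne fun r hr => by have := hr.1 δ' hδ' h1; linarith
      linarith
    · exact (le_csInf hne fun r hr => hr.2 θ' h1).trans h

/-- `L = L₁₁ + L₁₂² / (2μ)`. -/
def smoothConst (μ L11 L12 : ℝ) : ℝ := L11 + L12 ^ 2 / (2 * μ)

/-- `Φ_∞ = max {max_{δ ∈ Δ} ‖∇Φ(δ)‖, 1}`. -/
def phiInf {n d : ℕ} (f : Euc n → Euc d → ℝ) (Δ : Set (Euc n)) : ℝ :=
  max (sSup ((fun δ => ‖gradient (valueFn f) δ‖) '' Δ)) 1

/-- `L̄ = max {L₁₂, L₂₂, 1, Φ_∞}`. -/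
def Lbar (L12 L22 Φinf : ℝ) : ℝ := max (max L12 L22) (max 1 Φinf)

/-- `κ = 2 L̄ / μ²`. -/
def condNum (μ L12 L22 Φinf : ℝ) : ℝ := 2 * Lbar L12 L22 Φinf / μ ^ 2

/-- The learner's step size `η₁ = μ / L₂₂`. -/
def stepTheta (μ L22 : ℝ) : ℝ := μ / L22

/-- The attacker's step size `η₂ = min {1 / (32 L), 1 / (8 κ² L̄)}`. -/
def stepDelta (μ L11 L12 L22 Φinf : ℝ) : ℝ :=
  min (1 / (32 * smoothConst μ L11 L12))
    (1 / (8 * condNum μ L12 L22 Φinf ^ 2 * Lbar L12 L22 Φinf))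

/-- `D_Φ = Φ(δ₀) - min_{δ ∈ Δ} Φ(δ)`. -/
def valueGap {n d : ℕ} (f : Euc n → Euc d → ℝ) (Δ : Set (Euc n)) (δ₀ : Euc n) : ℝ :=
  valueFn f δ₀ - sInf (valueFn f '' Δ)

end

/-! The proof is a Lyapunov argument for `Φ + c W`, where `W = ‖θ - θ*(δ)‖² + 2η(Φ(δ) - f(δ, θ))`
measures how well the learner tracks the best response. RSI makes `θ*` Lipschitz with constant `L12
/ μ`, so `Φ` has quadratic upper and lower models and `∇Φ(δ) = ∇_δ f(δ, θ*(δ))`.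

At the step size `μ / L22` the squared distance alone need not contract, because of the term `η²‖∇_θ
f‖²`. The function gap in `W` cancels exactly this term, so an ascent step lowers `W` by `2ημ‖θ -
θ*‖²` up to noise (`MinimaxRSI.trackingEnergy_step`). Moving the attack raises `W` by a cross term
and a term quadratic in the attacker's step (`MinimaxRSI.trackingEnergy_drift`); the attacker's step
lowers `Φ` up to tracking error and noise (`MinimaxRSI.valueFn_step`). With `c = 2γL̄²/(ημ)` and
small `γ = η₂`, the two decreases pay for the coupling, leaving a surplus in `‖δ' - δ‖²` and `‖θ -
θ*‖²` (`MinimaxRSI.energy_step`).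

In expectation the noise term linear in the learner's error vanishes by unbiasedness, and the
quadratic ones cost a multiple of `σ²/M`. Telescoping yields an index with small expected surplus.
The projection inequality bounds the stationarity residual at `(δ_t, θ_t)` by step length, tracking
error and noise; Young's inequality turns this into `ε/2` plus a multiple of their squares, so
second moments suffice (`MinimaxRSI.fospResidual_le`). -/

/-! ### Quadratic models from Lipschitz gradients. -/

/-- Quadratic upper model of a function whose gradient is Lipschitz along a segment. -/
theorem sub_le_inner_add_of_lipschitz_gradient {E : Type*} [NormedAddCommGroup E]
    [InnerProductSpace ℝ E] [CompleteSpace E] {φ : E → ℝ} {G : E → E} {x y : E} {L : ℝ}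
    (hG : ∀ z ∈ segment ℝ x y, HasGradientAt φ (G z) z)
    (hL : ∀ z ∈ segment ℝ x y, ‖G z - G x‖ ≤ L * ‖z - x‖) :
    φ y ≤ φ x + inner ℝ (G x) (y - x) + L / 2 * ‖y - x‖ ^ 2 := by
  have hseg : ∀ t ∈ Set.Icc (0 : ℝ) 1, x + t • (y - x) ∈ segment ℝ x y := fun t ht => by
    rw [segment_eq_image']; exact ⟨t, ht, rfl⟩
  -- The function minus its claimed majorant along the segment has nonpositive derivative, so
  -- comparing the endpoints suffices and no integral of the gradient is needed.
  have hd : ∀ t ∈ Set.Icc (0 : ℝ) 1, HasDerivAt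
      (fun s : ℝ => φ (x + s • (y - x)) - s * inner ℝ (G x) (y - x)
        - L / 2 * s ^ 2 * ‖y - x‖ ^ 2)
      (inner ℝ (G (x + t • (y - x))) (y - x) - inner ℝ (G x) (y - x) - L * t * ‖y - x‖ ^ 2)
      t := by
    intro t ht
    have h1 : HasDerivAt (fun s : ℝ => x + s • (y - x)) (y - x) t := by
      simpa using ((hasDerivAt_id t).smul_const (y - x)).const_add x
    have h2 := (hG _ (hseg t ht)).hasFDerivAt.comp_hasDerivAt t h1
    have h3 := (hasDerivAt_id t).mul_const (inner ℝ (G x) (y - x))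
    have h4 := (((hasDerivAt_id t).pow 2).const_mul (L / 2)).mul_const (‖y - x‖ ^ 2)
    refine ((h2.sub h3).sub h4).congr_deriv ?_
    simp [-mul_eq_mul_right_iff]
    ring
  have hanti : AntitoneOn (fun s : ℝ => φ (x + s • (y - x)) - s * inner ℝ (G x) (y - x)
        - L / 2 * s ^ 2 * ‖y - x‖ ^ 2) (Set.Icc 0 1) := by
    refine antitoneOn_of_hasDerivWithinAt_nonpos (convex_Icc 0 1)
      (fun t ht => (hd t ht).continuousAt.continuousWithinAt)
      (fun t ht => (hd t (interior_subset ht)).hasDerivWithinAt) fun t ht => ?_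
    have ht := interior_subset ht
    have h1 := hL _ (hseg t ht)
    have h2 := real_inner_le_norm (G (x + t • (y - x)) - G x) (y - x)
    rw [add_sub_cancel_left, norm_smul, Real.norm_of_nonneg ht.1] at h1
    rw [inner_sub_left] at h2
    nlinarith [mul_le_mul_of_nonneg_right h1 (norm_nonneg (y - x))]
  have := hanti (Set.left_mem_Icc.2 zero_le_one) (Set.right_mem_Icc.2 zero_le_one) zero_le_one
  simp at this
  linarith

/-- Quadratic lower model of a function whose gradient is Lipschitz along a segment. -/
theorem inner_sub_le_sub_of_lipschitz_gradient {E : Type*} [NormedAddCommGroup E]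
    [InnerProductSpace ℝ E] [CompleteSpace E] {φ : E → ℝ} {G : E → E} {x y : E} {L : ℝ}
    (hG : ∀ z ∈ segment ℝ x y, HasGradientAt φ (G z) z)
    (hL : ∀ z ∈ segment ℝ x y, ‖G z - G x‖ ≤ L * ‖z - x‖) :
    φ x + inner ℝ (G x) (y - x) - L / 2 * ‖y - x‖ ^ 2 ≤ φ y := by
  have h := sub_le_inner_add_of_lipschitz_gradient (φ := fun z => -φ z) (G := fun z => -G z)
    (x := x) (y := y) (L := L)
    (fun z hz => by
      have := (hG z hz).hasFDerivAt.neg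
      rw [hasGradientAt_iff_hasFDerivAt, map_neg]; exact this)
    (fun z hz => by rw [← neg_sub', norm_neg]; exact hL z hz)
  rw [inner_neg_left] at h
  linarith

/-! ### Best response and value function: regularity and Danskin's formula. -/

section Analysis

variable {n d : ℕ} {f : Euc n → Euc d → ℝ} {U : Set (Euc n)} {μ L11 L12 L22 : ℝ}
  {θstar : Euc n → Euc d}

theorem LipschitzGradients.differentiableAt (hG : LipschitzGradients f U L11 L12 L22)
    (hU : IsOpen U) {δ : Euc n} (hδ : δ ∈ U) (θ : Euc d) :
    DifferentiableAt ℝ (fun p : Euc n × Euc d => f p.1 p.2) (δ, θ) :=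
  (hG.contDiff.differentiableOn one_ne_zero).differentiableAt
    ((hU.prod isOpen_univ).mem_nhds ⟨hδ, trivial⟩)

theorem LipschitzGradients.hasGradientAt_delta (hG : LipschitzGradients f U L11 L12 L22)
    (hU : IsOpen U) {δ : Euc n} (hδ : δ ∈ U) (θ : Euc d) :
    HasGradientAt (fun x => f x θ) (gradDelta f δ θ) δ :=
  DifferentiableAt.hasGradientAt <| (hG.differentiableAt hU hδ θ).comp δ
    (f := fun x : Euc n => (x, θ)) (by fun_prop)

theorem LipschitzGradients.hasGradientAt_theta (hG : LipschitzGradients f U L11 L12 L22)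
    (hU : IsOpen U) {δ : Euc n} (hδ : δ ∈ U) (θ : Euc d) :
    HasGradientAt (fun y => f δ y) (gradTheta f δ θ) θ :=
  DifferentiableAt.hasGradientAt <| (hG.differentiableAt hU hδ θ).comp θ
    (f := fun y : Euc d => (δ, y)) (by fun_prop)

theorem MinimaxRSI.gradTheta_eq_zero (hR : MinimaxRSI f U μ θstar) {δ : Euc n} (hδ : δ ∈ U) :
    gradTheta f δ (θstar δ) = 0 := by
  have hmax : IsLocalMax (fun y => f δ y) (θstar δ) :=
    Filter.Eventually.of_forall fun θ => hR.isMax δ hδ θ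
  unfold gradTheta gradient
  rw [hmax.fderiv_eq_zero, map_zero]

theorem MinimaxRSI.valueFn_eq (hR : MinimaxRSI f U μ θstar) {δ : Euc n} (hδ : δ ∈ U) :
    valueFn f δ = f δ (θstar δ) :=
  le_antisymm (ciSup_le fun θ => hR.isMax δ hδ θ)
    (le_ciSup (f := fun θ => f δ θ) ⟨_, by rintro _ ⟨θ, rfl⟩; exact hR.isMax δ hδ θ⟩ (θstar δ))

theorem MinimaxRSI.le_valueFn (hR : MinimaxRSI f U μ θstar) {δ : Euc n} (hδ : δ ∈ U)
    (θ : Euc d) : f δ θ ≤ valueFn f δ := by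
  rw [hR.valueFn_eq hδ]; exact hR.isMax δ hδ θ

/-- The maximizer is `L₁₂ / μ`-Lipschitz. -/
theorem MinimaxRSI.norm_thetaStar_sub_le (hR : MinimaxRSI f U μ θstar)
    (hG : LipschitzGradients f U L11 L12 L22) (hμ : 0 < μ) (hL12 : 0 ≤ L12) {δ₁ δ₂ : Euc n}
    (h₁ : δ₁ ∈ U) (h₂ : δ₂ ∈ U) :
    ‖θstar δ₁ - θstar δ₂‖ ≤ L12 / μ * ‖δ₁ - δ₂‖ := by
  -- RSI at `δ₁` is tested at the maximizer for `δ₂`, where the gradient for `δ₂` vanishes; only the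
  -- change of gradient between the two attacks remains.
  have h := hR.rsi δ₁ h₁ (θstar δ₂)
  have h' := real_inner_le_norm (gradTheta f δ₁ (θstar δ₂)) (θstar δ₁ - θstar δ₂)
  have h3 := hG.lip21 δ₁ h₁ δ₂ h₂ (θstar δ₂)
  rw [hR.gradTheta_eq_zero h₂, sub_zero] at h3
  rw [div_mul_eq_mul_div, le_div_iff₀ hμ]
  rcases (norm_nonneg (θstar δ₁ - θstar δ₂)).eq_or_lt with h0 | h0
  · rw [← h0, zero_mul]; positivity
  · refine le_of_mul_le_mul_right ?_ h0
    nlinarith [mul_le_mul_of_nonneg_right h3 h0.le]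

theorem MinimaxRSI.norm_gradTheta_le (hR : MinimaxRSI f U μ θstar)
    (hG : LipschitzGradients f U L11 L12 L22) {δ : Euc n} (hδ : δ ∈ U) (θ : Euc d) :
    ‖gradTheta f δ θ‖ ≤ L22 * ‖θ - θstar δ‖ := by
  simpa [hR.gradTheta_eq_zero hδ] using hG.lip22 δ hδ θ (θstar δ)

theorem MinimaxRSI.inner_gradTheta_le (hR : MinimaxRSI f U μ θstar) {δ : Euc n} (hδ : δ ∈ U)
    (θ : Euc d) : inner ℝ (θ - θstar δ) (gradTheta f δ θ) ≤ -(μ * ‖θ - θstar δ‖ ^ 2) := by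
  have h := hR.rsi δ hδ θ
  rw [norm_sub_rev, ← neg_sub θ, inner_neg_right, real_inner_comm] at h
  linarith

/-- RSI and the Lipschitz bound sandwich the same inner product. The norm factor stays because `μ ≤
L22` itself can fail when `d = 0`. -/
theorem MinimaxRSI.mu_mul_le (hR : MinimaxRSI f U μ θstar)
    (hG : LipschitzGradients f U L11 L12 L22) {δ : Euc n} (hδ : δ ∈ U) (θ : Euc d) :
    μ * ‖θ - θstar δ‖ ≤ L22 * ‖θ - θstar δ‖ := by
  have h1 := hR.inner_gradTheta_le hδ θ
  have h2 := hR.norm_gradTheta_le hG hδ θ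
  have h3 := neg_le_of_abs_le (abs_real_inner_le_norm (θ - θstar δ) (gradTheta f δ θ))
  rcases (norm_nonneg (θ - θstar δ)).eq_or_lt with h0 | h0
  · simp [← h0]
  · refine le_of_mul_le_mul_right ?_ h0
    nlinarith [mul_le_mul_of_nonneg_right h2 h0.le]

theorem LipschitzGradients.le_of_segment_subset (hG : LipschitzGradients f U L11 L12 L22)
    (hU : IsOpen U) {x y : Euc n} (hs : segment ℝ x y ⊆ U) (θ : Euc d) :
    f y θ ≤ f x θ + inner ℝ (gradDelta f x θ) (y - x) + L11 / 2 * ‖y - x‖ ^ 2 :=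
  sub_le_inner_add_of_lipschitz_gradient (φ := fun z => f z θ) (G := fun z => gradDelta f z θ)
    (fun _ hz => hG.hasGradientAt_delta hU (hs hz) θ)
    (fun z hz => hG.lip11 z (hs hz) x (hs (left_mem_segment ℝ x y)) θ)

theorem LipschitzGradients.ge_of_segment_subset (hG : LipschitzGradients f U L11 L12 L22)
    (hU : IsOpen U) {x y : Euc n} (hs : segment ℝ x y ⊆ U) (θ : Euc d) :
    f x θ + inner ℝ (gradDelta f x θ) (y - x) - L11 / 2 * ‖y - x‖ ^ 2 ≤ f y θ :=
  inner_sub_le_sub_of_lipschitz_gradient (φ := fun z => f z θ) (G := fun z => gradDelta f z θ)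
    (fun _ hz => hG.hasGradientAt_delta hU (hs hz) θ)
    (fun z hz => hG.lip11 z (hs hz) x (hs (left_mem_segment ℝ x y)) θ)

theorem LipschitzGradients.ge_theta (hG : LipschitzGradients f U L11 L12 L22)
    (hU : IsOpen U) {δ : Euc n} (hδ : δ ∈ U) (x y : Euc d) :
    f δ x + inner ℝ (gradTheta f δ x) (y - x) - L22 / 2 * ‖y - x‖ ^ 2 ≤ f δ y :=
  inner_sub_le_sub_of_lipschitz_gradient (φ := fun z => f δ z) (G := fun z => gradTheta f δ z)
    (fun z _ => hG.hasGradientAt_theta hU hδ z) (fun z _ => hG.lip22 δ hδ z x)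

theorem MinimaxRSI.valueFn_sub_le (hR : MinimaxRSI f U μ θstar)
    (hG : LipschitzGradients f U L11 L12 L22) (hU : IsOpen U) {δ : Euc n} (hδ : δ ∈ U)
    (θ : Euc d) : valueFn f δ - f δ θ ≤ L22 / 2 * ‖θ - θstar δ‖ ^ 2 := by
  have h := hG.ge_theta hU hδ (θstar δ) θ
  rw [hR.gradTheta_eq_zero hδ, inner_zero_left, ← hR.valueFn_eq hδ] at h
  linarith

/-- Expand at the new maximizer `θstar y`, which is suboptimal at `x`. Replacing it by `θstar x` in
the gradient costs `L12` times the Lipschitz constant `L12 / μ`. -/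
theorem MinimaxRSI.valueFn_le (hR : MinimaxRSI f U μ θstar)
    (hG : LipschitzGradients f U L11 L12 L22) (hμ : 0 < μ) (hL12 : 0 ≤ L12) (hU : IsOpen U)
    {x y : Euc n} (hs : segment ℝ x y ⊆ U) :
    valueFn f y ≤ valueFn f x + inner ℝ (gradDelta f x (θstar x)) (y - x)
      + (L11 / 2 + L12 ^ 2 / μ) * ‖y - x‖ ^ 2 := by
  have hx := hs (left_mem_segment ℝ x y)
  have hy := hs (right_mem_segment ℝ x y)
  have h1 := hG.le_of_segment_subset hU hs (θstar y)
  have h2 := hR.le_valueFn hx (θstar y)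
  have h3 := real_inner_le_norm (gradDelta f x (θstar y) - gradDelta f x (θstar x)) (y - x)
  have h4 := hG.lip12 x hx (θstar y) (θstar x)
  have h5 := hR.norm_thetaStar_sub_le hG hμ hL12 hy hx
  rw [inner_sub_left] at h3
  have h6 : ‖gradDelta f x (θstar y) - gradDelta f x (θstar x)‖
      ≤ L12 ^ 2 / μ * ‖y - x‖ := by
    calc _ ≤ _ := h4
      _ ≤ L12 * (L12 / μ * ‖y - x‖) := by gcongr
      _ = _ := by ring
  have h7 := mul_le_mul_of_nonneg_right h6 (norm_nonneg (y - x))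
  rw [hR.valueFn_eq hy]
  nlinarith

/-- Keeping the old maximizer fixed gives a lower bound, so only the curvature in `δ` enters. -/
theorem MinimaxRSI.le_valueFn_of_segment (hR : MinimaxRSI f U μ θstar)
    (hG : LipschitzGradients f U L11 L12 L22) (hU : IsOpen U)
    {x y : Euc n} (hs : segment ℝ x y ⊆ U) :
    valueFn f x + inner ℝ (gradDelta f x (θstar x)) (y - x) - L11 / 2 * ‖y - x‖ ^ 2
      ≤ valueFn f y := by
  rw [hR.valueFn_eq (hs (left_mem_segment ℝ x y))]
  exact (hG.ge_of_segment_subset hU hs _).trans (hR.le_valueFn (hs (right_mem_segment ℝ x y)) _)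

/-- Danskin's theorem: `∇Φ(δ) = ∇_δ f(δ, θ*(δ))`. -/
theorem MinimaxRSI.hasGradientAt_valueFn (hR : MinimaxRSI f U μ θstar)
    (hG : LipschitzGradients f U L11 L12 L22) (hμ : 0 < μ) (hL12 : 0 ≤ L12)
    (hU : IsOpen U) {x : Euc n} (hx : x ∈ U) :
    HasGradientAt (valueFn f) (gradDelta f x (θstar x)) x := by
  obtain ⟨r, hr, hball⟩ := Metric.isOpen_iff.1 hU x hx
  rw [hasGradientAt_iff_isLittleO]
  -- The two quadratic models squeeze the linearization error to second order on a ball inside `U`.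
  refine Asymptotics.IsBigO.trans_isLittleO (g := fun y => ‖y - x‖ ^ 2) ?_ ?_
  · refine Asymptotics.IsBigO.of_bound (L11 / 2 + L12 ^ 2 / μ) ?_
    filter_upwards [Metric.ball_mem_nhds x hr] with y hy
    have hs : segment ℝ x y ⊆ U :=
      ((convex_ball x r).segment_subset (Metric.mem_ball_self hr) hy).trans hball
    have h1 := hR.valueFn_le hG hμ hL12 hU hs
    have h2 := hR.le_valueFn_of_segment hG hU hs
    have h3 : 0 ≤ L12 ^ 2 / μ * ‖y - x‖ ^ 2 := by positivity
    rw [Real.norm_eq_abs, Real.norm_of_nonneg (by positivity), abs_le]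
    constructor <;> linarith
  · have := Asymptotics.isLittleO_pow_sub_sub x (one_lt_two)
    simpa using this

theorem MinimaxRSI.gradient_valueFn (hR : MinimaxRSI f U μ θstar)
    (hG : LipschitzGradients f U L11 L12 L22) (hμ : 0 < μ) (hL12 : 0 ≤ L12)
    (hU : IsOpen U) {x : Euc n} (hx : x ∈ U) :
    gradient (valueFn f) x = gradDelta f x (θstar x) :=
  (hR.hasGradientAt_valueFn hG hμ hL12 hU hx).gradient

theorem LipschitzGradients.continuousOn_gradDelta (hG : LipschitzGradients f U L11 L12 L22)
    (hL11 : 0 ≤ L11) (hL12 : 0 ≤ L12) :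
    ContinuousOn (fun p : Euc n × Euc d => gradDelta f p.1 p.2) (U ×ˢ Set.univ) := by
  refine (LipschitzOnWith.of_dist_le_mul (K := (L11 + L12).toNNReal) ?_).continuousOn
  rintro ⟨a, b⟩ ⟨ha, -⟩ ⟨a', b'⟩ ⟨ha', -⟩
  rw [Real.coe_toNNReal _ (by positivity), Prod.dist_eq, dist_eq_norm]
  have h1 := hG.lip11 a ha a' ha' b
  have h2 := hG.lip12 a' ha' b b'
  have h3 := norm_sub_le_norm_sub_add_norm_sub (gradDelta f a b) (gradDelta f a' b)
    (gradDelta f a' b')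
  rw [← dist_eq_norm a] at h1
  rw [← dist_eq_norm b] at h2
  have h4 := mul_le_mul_of_nonneg_left (le_max_left (dist a a') (dist b b')) hL11
  have h5 := mul_le_mul_of_nonneg_left (le_max_right (dist a a') (dist b b')) hL12
  simp only at *
  linarith

theorem LipschitzGradients.continuousOn_gradTheta (hG : LipschitzGradients f U L11 L12 L22)
    (hL22 : 0 ≤ L22) (hL12 : 0 ≤ L12) :
    ContinuousOn (fun p : Euc n × Euc d => gradTheta f p.1 p.2) (U ×ˢ Set.univ) := by
  refine (LipschitzOnWith.of_dist_le_mul (K := (L12 + L22).toNNReal) ?_).continuousOn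
  rintro ⟨a, b⟩ ⟨ha, -⟩ ⟨a', b'⟩ ⟨ha', -⟩
  rw [Real.coe_toNNReal _ (by positivity), Prod.dist_eq, dist_eq_norm]
  have h1 := hG.lip21 a ha a' ha' b
  have h2 := hG.lip22 a' ha' b b'
  have h3 := norm_sub_le_norm_sub_add_norm_sub (gradTheta f a b) (gradTheta f a' b)
    (gradTheta f a' b')
  rw [← dist_eq_norm a] at h1
  rw [← dist_eq_norm b] at h2
  have h4 := mul_le_mul_of_nonneg_left (le_max_left (dist a a') (dist b b')) hL12
  have h5 := mul_le_mul_of_nonneg_left (le_max_right (dist a a') (dist b b')) hL22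
  simp only at *
  linarith

theorem MinimaxRSI.continuousOn_thetaStar (hR : MinimaxRSI f U μ θstar)
    (hG : LipschitzGradients f U L11 L12 L22) (hμ : 0 < μ) (hL12 : 0 ≤ L12) :
    ContinuousOn θstar U := by
  refine (LipschitzOnWith.of_dist_le_mul (K := (L12 / μ).toNNReal) ?_).continuousOn
  intro a ha b hb
  rw [Real.coe_toNNReal _ (by positivity), dist_eq_norm, dist_eq_norm]
  exact hR.norm_thetaStar_sub_le hG hμ hL12 ha hb

theorem MinimaxRSI.continuousOn_valueFn (hR : MinimaxRSI f U μ θstar)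
    (hG : LipschitzGradients f U L11 L12 L22) (hμ : 0 < μ) (hL12 : 0 ≤ L12)
    (hU : IsOpen U) : ContinuousOn (valueFn f) U := fun _ hx =>
  (hR.hasGradientAt_valueFn hG hμ hL12 hU hx).differentiableAt.continuousAt.continuousWithinAt

/-- Continuity of `∇Φ` on the compact `Δ` makes the `sSup` in `phiInf` a genuine upper bound. -/
theorem MinimaxRSI.norm_gradDelta_thetaStar_le (hR : MinimaxRSI f U μ θstar)
    (hG : LipschitzGradients f U L11 L12 L22) (hμ : 0 < μ) (hL11 : 0 ≤ L11) (hL12 : 0 ≤ L12)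
    (hU : IsOpen U) {Δ : Set (Euc n)} (hΔU : Δ ⊆ U) (hΔ : IsCompact Δ) {x : Euc n}
    (hx : x ∈ Δ) : ‖gradDelta f x (θstar x)‖ ≤ phiInf f Δ := by
  have hc : ContinuousOn (fun δ => ‖gradDelta f δ (θstar δ)‖) Δ :=
    ((hG.continuousOn_gradDelta hL11 hL12).comp
      (continuousOn_id.prodMk (hR.continuousOn_thetaStar hG hμ hL12)) (fun _ h => ⟨h, trivial⟩)
      |>.mono hΔU).norm
  have hc' : ContinuousOn (fun δ => ‖gradient (valueFn f) δ‖) Δ := hc.congr fun δ hδ => by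
    simp only [hR.gradient_valueFn hG hμ hL12 hU (hΔU hδ)]
  rw [← hR.gradient_valueFn hG hμ hL12 hU (hΔU hx)]
  exact (le_csSup (hΔ.bddAbove_image hc') (Set.mem_image_of_mem _ hx)).trans (le_max_left _ _)

end Analysis

/-! ### Pathwise inequalities for one step. -/

noncomputable section

theorem IsProjection.inner_le_zero {n : ℕ} {Δ : Set (Euc n)} (hΔ : Convex ℝ Δ) {x p : Euc n}
    (h : IsProjection Δ x p) {q : Euc n} (hq : q ∈ Δ) : inner ℝ (x - p) (q - p) ≤ 0 := by
  refine (norm_eq_iInf_iff_real_inner_le_zero hΔ h.1).1 ?_ q hq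
  have : Nonempty Δ := ⟨⟨p, h.1⟩⟩
  exact le_antisymm (le_ciInf fun w => h.2 w w.2)
    (ciInf_le (f := fun w : Δ => ‖x - w‖)
      ⟨0, by rintro _ ⟨w, rfl⟩; exact norm_nonneg _⟩ ⟨p, h.1⟩)

/-- The projected step is a descent step up to the projection residual. -/
theorem IsProjection.inner_step_le {n : ℕ} {Δ : Set (Euc n)} (hΔ : Convex ℝ Δ) {γ : ℝ}
    (hγ : 0 < γ) {δ δ' g x : Euc n} (h : IsProjection Δ (δ - γ • g) δ') (hx : x ∈ Δ) :
    inner ℝ g (δ' - x) ≤ 1 / γ * inner ℝ (δ' - δ) (x - δ') := by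
  have h1 := h.inner_le_zero hΔ hx
  have h2 : δ - γ • g - δ' = -(δ' - δ) - γ • g := by abel
  rw [h2, inner_sub_left, inner_neg_left, real_inner_smul_left] at h1
  rw [← neg_sub x δ', inner_neg_right, one_div, inv_mul_eq_div, le_div_iff₀ hγ]
  linarith

/-- Lyapunov function for the learner's tracking of the maximizer. -/
def trackingEnergy {n d : ℕ} (f : Euc n → Euc d → ℝ) (θstar : Euc n → Euc d) (η : ℝ)
    (δ : Euc n) (θ : Euc d) : ℝ :=
  ‖θ - θstar δ‖ ^ 2 + 2 * η * (valueFn f δ - f δ θ)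

/-- The direction in which the learner's gradient noise enters the tracking energy. -/
def trackingDirection {n d : ℕ} (f : Euc n → Euc d → ℝ) (θstar : Euc n → Euc d) (η : ℝ)
    (δ : Euc n) (θ : Euc d) : Euc d :=
  (2 * η) • (θ - θstar δ) + (2 * η ^ 2) • gradTheta f δ θ

section Steps

variable {n d : ℕ} {f : Euc n → Euc d → ℝ} {U Δ : Set (Euc n)} {μ L11 L12 L22 η γ : ℝ}
  {θstar : Euc n → Euc d}

theorem MinimaxRSI.sq_le_trackingEnergy (hR : MinimaxRSI f U μ θstar) (hη : 0 ≤ η)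
    {δ : Euc n} (hδ : δ ∈ U) (θ : Euc d) :
    ‖θ - θstar δ‖ ^ 2 ≤ trackingEnergy f θstar η δ θ := by
  have := mul_nonneg (mul_nonneg zero_le_two hη) (sub_nonneg.2 (hR.le_valueFn hδ θ))
  unfold trackingEnergy
  linarith

theorem MinimaxRSI.trackingEnergy_le (hR : MinimaxRSI f U μ θstar)
    (hG : LipschitzGradients f U L11 L12 L22) (hU : IsOpen U) (hη : 0 ≤ η) (hηL : η * L22 ≤ 1)
    {δ : Euc n} (hδ : δ ∈ U) (θ : Euc d) :
    trackingEnergy f θstar η δ θ ≤ 2 * ‖θ - θstar δ‖ ^ 2 := by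
  have h1 := mul_le_mul_of_nonneg_left (hR.valueFn_sub_le hG hU hδ θ)
    (mul_nonneg zero_le_two hη)
  have h2 := mul_le_mul_of_nonneg_right hηL (sq_nonneg ‖θ - θstar δ‖)
  unfold trackingEnergy
  nlinarith

/-- One stochastic gradient ascent step of the learner against a fixed attack. -/
theorem MinimaxRSI.trackingEnergy_step (hR : MinimaxRSI f U μ θstar)
    (hG : LipschitzGradients f U L11 L12 L22) (hU : IsOpen U) (hη : 0 ≤ η) (hηL : η * L22 ≤ 1)
    {δ : Euc n} (hδ : δ ∈ U) (θ g : Euc d) :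
    trackingEnergy f θstar η δ (θ + η • g) ≤ trackingEnergy f θstar η δ θ
      - 2 * (η * μ) * ‖θ - θstar δ‖ ^ 2
      + inner ℝ (trackingDirection f θstar η δ θ) (g - gradTheta f δ θ)
      + 2 * η ^ 2 * ‖g - gradTheta f δ θ‖ ^ 2 := by
  have h1 := hG.ge_theta hU hδ θ (θ + η • g)
  have h2 := hR.inner_gradTheta_le hδ θ
  obtain ⟨e, rfl⟩ : ∃ e, g = gradTheta f δ θ + e := ⟨g - gradTheta f δ θ, by abel⟩
  unfold trackingEnergy trackingDirection
  have h3 : θ + η • (gradTheta f δ θ + e) - θstar δ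
      = (θ - θstar δ) + η • (gradTheta f δ θ + e) := by abel
  rw [add_sub_cancel_left] at h1
  rw [h3, add_sub_cancel_left]
  generalize gradTheta f δ θ = g at *
  generalize θ - θstar δ = p at *
  have h4 : ‖g + e‖ ^ 2 = ‖g‖ ^ 2 + 2 * inner ℝ g e + ‖e‖ ^ 2 := norm_add_sq_real g e
  rw [norm_add_sq_real]
  rw [norm_smul, Real.norm_of_nonneg hη, mul_pow] at *
  simp only [real_inner_smul_right, real_inner_smul_left, inner_add_left, inner_add_right,
    real_inner_self_eq_norm_sq] at *
  -- With `g` the exact gradient and `e` the noise, the squared distance and the curvature loss each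
  -- contribute at most `η²‖g + e‖²`, while the gain in `f` contributes `-2η²⟨g, g + e⟩`. The `‖g‖²`
  -- terms cancel, which dictates the weight `2η` in the energy.
  have h5 := mul_le_mul_of_nonneg_left h1 (mul_nonneg zero_le_two hη)
  have h6 := mul_le_mul_of_nonneg_right hηL (mul_nonneg (sq_nonneg η) (sq_nonneg ‖g + e‖))
  have h7 := mul_le_mul_of_nonneg_left h2 (mul_nonneg zero_le_two hη)
  nlinarith

/-- Change of the tracking energy when the attack moves. -/
theorem MinimaxRSI.trackingEnergy_drift (hR : MinimaxRSI f U μ θstar)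
    (hG : LipschitzGradients f U L11 L12 L22) (hU : IsOpen U) (hμ : 0 < μ) (hμ1 : μ ≤ 1)
    (hL11 : 0 ≤ L11) (hL12 : 0 ≤ L12) (hL22 : 0 < L22) {δ δ' : Euc n}
    (hs : segment ℝ δ δ' ⊆ U) (θ : Euc d) :
    trackingEnergy f θstar (μ / L22) δ' θ ≤ trackingEnergy f θstar (μ / L22) δ θ
      + 4 * (L12 / μ) * ‖θ - θstar δ‖ * ‖δ' - δ‖
      + ((L12 / μ) ^ 2 + 6 * (μ / L22) * smoothConst μ L11 L12) * ‖δ' - δ‖ ^ 2 := by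
  have hδ := hs (left_mem_segment ℝ δ δ')
  have hδ' := hs (right_mem_segment ℝ δ δ')
  have hη : 0 < μ / L22 := by positivity
  have h1 : ‖θ - θstar δ'‖ ≤ ‖θ - θstar δ‖ + L12 / μ * ‖δ' - δ‖ := by
    have := hR.norm_thetaStar_sub_le hG hμ hL12 hδ hδ'
    rw [norm_sub_rev δ] at this
    linarith [norm_sub_le_norm_sub_add_norm_sub θ (θstar δ) (θstar δ')]
  have h2 := hR.valueFn_le hG hμ hL12 hU hs
  have h3 := hG.ge_of_segment_subset hU hs θ
  have h4 := real_inner_le_norm (gradDelta f δ (θstar δ) - gradDelta f δ θ) (δ' - δ)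
  have h5 := hG.lip12 δ hδ (θstar δ) θ
  rw [norm_sub_rev (θstar δ)] at h5
  rw [inner_sub_left] at h4
  have h6 := mul_le_mul_of_nonneg_right h5 (norm_nonneg (δ' - δ))
  have h7 : μ / L22 * ‖θ - θstar δ‖ ≤ ‖θ - θstar δ‖ := by
    rw [div_mul_eq_mul_div, div_le_iff₀ hL22, mul_comm _ L22]
    exact hR.mu_mul_le hG hδ θ
  have h8 : L11 + L12 ^ 2 / μ ≤ 3 * smoothConst μ L11 L12 := by
    have : L12 ^ 2 / (2 * μ) = L12 ^ 2 / μ / 2 := by rw [mul_comm, div_div]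
    have h0 : 0 ≤ L12 ^ 2 / μ := by positivity
    unfold smoothConst
    linarith
  have h9 : L12 ≤ L12 / μ := by
    rw [le_div_iff₀ hμ]; nlinarith
  have h10 : valueFn f δ' - f δ' θ ≤ valueFn f δ - f δ θ + L12 * ‖θ - θstar δ‖ * ‖δ' - δ‖
      + 3 * smoothConst μ L11 L12 * ‖δ' - δ‖ ^ 2 := by
    have := mul_le_mul_of_nonneg_right h8 (sq_nonneg ‖δ' - δ‖)
    linarith
  -- The coefficient 4 of the cross term is 2 from the squared distance plus 2 from the function
  -- gap, whose cross term is reduced here to the same form.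
  have h11 : μ / L22 * (L12 * ‖θ - θstar δ‖ * ‖δ' - δ‖)
      ≤ L12 / μ * ‖θ - θstar δ‖ * ‖δ' - δ‖ := by
    calc _ = L12 * (μ / L22 * ‖θ - θstar δ‖) * ‖δ' - δ‖ := by ring
      _ ≤ _ := by gcongr
  have h12 : ‖θ - θstar δ'‖ ^ 2 ≤ (‖θ - θstar δ‖ + L12 / μ * ‖δ' - δ‖) ^ 2 := by gcongr
  have h13 := mul_le_mul_of_nonneg_left h10 (mul_pos two_pos hη).le
  unfold trackingEnergy
  linarith

/-- The projected step gives `-1/γ`; Young's inequality spends `1/(4γ)` on the tracking bias and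
`1/(4γ)` on the noise, and curvature spends `1/(16γ)`, leaving `-7/(16γ)`. -/
theorem MinimaxRSI.valueFn_step (hR : MinimaxRSI f U μ θstar)
    (hG : LipschitzGradients f U L11 L12 L22) (hU : IsOpen U) (hμ : 0 < μ)
    (hL11 : 0 ≤ L11) (hL12 : 0 ≤ L12) (hΔU : Δ ⊆ U) (hΔ : Convex ℝ Δ) (hγ : 0 < γ)
    (hγL : γ * smoothConst μ L11 L12 ≤ 1 / 32) {δ δ' g : Euc n} (hδ : δ ∈ Δ)
    (hp : IsProjection Δ (δ - γ • g) δ') (θ : Euc d) :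
    valueFn f δ' ≤ valueFn f δ - 7 / (16 * γ) * ‖δ' - δ‖ ^ 2
      + γ * L12 ^ 2 * ‖θ - θstar δ‖ ^ 2 + γ * ‖g - gradDelta f δ θ‖ ^ 2 := by
  have h1 := hR.valueFn_le hG hμ hL12 hU ((hΔ.segment_subset hδ hp.1).trans hΔU)
  have h2 := hp.inner_step_le hΔ hγ hδ
  rw [← neg_sub δ' δ, inner_neg_right, real_inner_self_eq_norm_sq] at h2
  have h3 := real_inner_le_norm (gradDelta f δ (θstar δ) - gradDelta f δ θ) (δ' - δ)
  have h4 := mul_le_mul_of_nonneg_right (hG.lip12 δ (hΔU hδ) (θstar δ) θ) (norm_nonneg (δ' - δ))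
  have h5 := neg_le_of_abs_le (abs_real_inner_le_norm (g - gradDelta f δ θ) (δ' - δ))
  rw [norm_sub_rev (θstar δ)] at h4
  rw [inner_sub_left] at h3 h5
  have h6 : L11 / 2 + L12 ^ 2 / μ ≤ 1 / (16 * γ) := by
    have h0 : L12 ^ 2 / (2 * μ) = L12 ^ 2 / μ / 2 := by rw [mul_comm, div_div]
    rw [le_div_iff₀ (by positivity)]
    unfold smoothConst at hγL
    rw [h0] at hγL
    nlinarith
  have h7 := mul_le_mul_of_nonneg_right h6 (sq_nonneg ‖δ' - δ‖)
  have young : ∀ a b : ℝ, a * b ≤ γ * a ^ 2 + 1 / (4 * γ) * b ^ 2 := fun a b => by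
    have : γ * a ^ 2 + 1 / (4 * γ) * b ^ 2 - a * b = γ * (a - 1 / (2 * γ) * b) ^ 2 := by
      field_simp
      ring
    nlinarith [mul_nonneg hγ.le (sq_nonneg (a - 1 / (2 * γ) * b))]
  have h8 := young (L12 * ‖θ - θstar δ‖) ‖δ' - δ‖
  have h9 := young ‖g - gradDelta f δ θ‖ ‖δ' - δ‖
  have h10 : 7 / (16 * γ) = 7 / 16 * (1 / γ) := by field_simp
  have h11 : 1 / (16 * γ) = 1 / 16 * (1 / γ) := by field_simp
  have h12 : 1 / (4 * γ) = 1 / 4 * (1 / γ) := by field_simp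
  rw [h10]
  rw [h11] at h7
  rw [h12] at h8 h9
  linarith

/-- The coefficient bounds that make the two time scales compatible. -/
theorem coupling_coefficient_le {Lb : ℝ} (hμ : 0 < μ) (hμ1 : μ ≤ 1) (hL11 : 0 ≤ L11)
    (hL12 : 0 ≤ L12) (hL22 : 0 < L22) (hLb : 1 ≤ Lb) (h12 : L12 ≤ Lb) (h22 : L22 ≤ Lb)
    (hγ : 0 < γ) (hγL : γ * smoothConst μ L11 L12 ≤ 1 / 32) (hγκ : γ * Lb ^ 3 ≤ μ ^ 4 / 32) :
    2 * γ * Lb ^ 2 / (μ / L22 * μ) * ((8 / (μ / L22 * μ) + 1) * (L12 / μ) ^ 2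
      + 6 * (μ / L22) * smoothConst μ L11 L12) ≤ 1 / (16 * γ) := by
  have hL : 0 ≤ smoothConst μ L11 L12 := by unfold smoothConst; positivity
  generalize smoothConst μ L11 L12 = L at *
  have hμ4 : μ ^ 4 ≤ 1 := pow_le_one₀ hμ.le hμ1
  have hμ43 : μ ^ 4 ≤ μ ^ 3 := pow_le_pow_of_le_one hμ.le hμ1 (by norm_num)
  have hμ41 : μ ^ 4 ≤ μ := by simpa using pow_le_pow_of_le_one hμ.le hμ1 (show 1 ≤ 4 by norm_num)
  have hLb0 : 0 < Lb := by linarith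
  have ha : γ * Lb * L12 * L22 / μ ^ 3 ≤ 1 / 32 := by
    rw [div_le_iff₀ (by positivity)]
    calc γ * Lb * L12 * L22 ≤ γ * Lb * Lb * Lb := by gcongr
      _ = γ * Lb ^ 3 := by ring
      _ ≤ _ := by linarith
  have hb : γ * Lb ^ 2 ≤ 1 / 32 * μ ^ 4 := by
    calc γ * Lb ^ 2 ≤ γ * Lb ^ 3 := by gcongr; norm_num
      _ ≤ _ := by linarith
  have hc : γ * L12 ^ 2 * L22 ≤ 1 / 32 := by
    calc γ * L12 ^ 2 * L22 ≤ γ * Lb ^ 2 * Lb := by gcongr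
      _ = γ * Lb ^ 3 := by ring
      _ ≤ _ := by linarith
  have hd : γ * Lb ^ 2 / μ ≤ 1 / 32 := by
    rw [div_le_iff₀ hμ]; linarith
  have hb' : γ * Lb ^ 2 / μ ^ 4 ≤ 1 / 32 := by
    rw [div_le_iff₀ (by positivity)]; linarith
  rw [le_div_iff₀ (by positivity)]
  -- Every factor isolated here is at most `1/32`, so the total is at most `(256 + 32 + 192)/1024 <
  -- 1`.
  have key : 2 * γ * Lb ^ 2 / (μ / L22 * μ) * ((8 / (μ / L22 * μ) + 1) * (L12 / μ) ^ 2
      + 6 * (μ / L22) * L) * (16 * γ) = 256 * (γ * Lb * L12 * L22 / μ ^ 3) ^ 2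
      + 32 * (γ * Lb ^ 2 / μ ^ 4) * (γ * L12 ^ 2 * L22)
      + 192 * (γ * L) * (γ * Lb ^ 2 / μ) := by
    field_simp
    ring
  rw [key]
  have h1 : (γ * Lb * L12 * L22 / μ ^ 3) ^ 2 ≤ (1 / 32) ^ 2 := by gcongr
  have h2 : (γ * Lb ^ 2 / μ ^ 4) * (γ * L12 ^ 2 * L22) ≤ 1 / 32 * (1 / 32) := by gcongr
  have h3 : (γ * L) * (γ * Lb ^ 2 / μ) ≤ 1 / 32 * (1 / 32) := by gcongr
  linarith

/-- One step of Persistent Attack decreases the energy `Φ + c W`, up to noise. -/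
theorem MinimaxRSI.energy_step {Lb c : ℝ} (hR : MinimaxRSI f U μ θstar)
    (hG : LipschitzGradients f U L11 L12 L22) (hU : IsOpen U) (hμ : 0 < μ) (hμ1 : μ ≤ 1)
    (hL11 : 0 ≤ L11) (hL12 : 0 ≤ L12) (hL22 : 0 < L22) (hΔU : Δ ⊆ U) (hΔ : Convex ℝ Δ)
    (hLb : 1 ≤ Lb) (h12 : L12 ≤ Lb) (h22 : L22 ≤ Lb) (hγ : 0 < γ)
    (hγL : γ * smoothConst μ L11 L12 ≤ 1 / 32) (hγκ : γ * Lb ^ 3 ≤ μ ^ 4 / 32)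
    (hη : η = μ / L22) (hc : c = 2 * γ * Lb ^ 2 / (η * μ)) {δ δ' g : Euc n} (hδ : δ ∈ Δ)
    (hp : IsProjection Δ (δ - γ • g) δ') (θ h : Euc d) :
    valueFn f δ' + c * trackingEnergy f θstar η δ' (θ + η • h)
      + 1 / (4 * γ) * ‖δ' - δ‖ ^ 2 + γ * ‖θ - θstar δ‖ ^ 2
    ≤ valueFn f δ + c * trackingEnergy f θstar η δ θ + γ * ‖g - gradDelta f δ θ‖ ^ 2
      + c * (1 + η * μ / 2) * inner ℝ (trackingDirection f θstar η δ θ) (h - gradTheta f δ θ)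
      + c * (1 + η * μ / 2) * (2 * η ^ 2) * ‖h - gradTheta f δ θ‖ ^ 2 := by
  have hη0 : 0 < η := by rw [hη]; positivity
  have hηL : η * L22 ≤ 1 := by rw [hη, div_mul_cancel₀ _ hL22.ne']; exact hμ1
  have hLb0 : 0 < Lb := by linarith
  have hc0 : 0 < c := by rw [hc]; positivity
  have h1 := hR.valueFn_step hG hU hμ hL11 hL12 hΔU hΔ hγ hγL hδ hp θ
  have h2 := hR.trackingEnergy_drift hG hU hμ hμ1 hL11 hL12 hL22
    ((hΔ.segment_subset hδ hp.1).trans hΔU) (θ + η • h)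
  have h3 := hR.trackingEnergy_step hG hU hη0.le hηL (hΔU hδ) θ h
  have h4 := hR.trackingEnergy_le hG hU hη0.le hηL (hΔU hδ) θ
  have h5 := hR.sq_le_trackingEnergy hη0.le (hΔU hδ) (θ + η • h)
  have h6 := coupling_coefficient_le hμ hμ1 hL11 hL12 hL22 hLb h12 h22 hγ hγL hγκ
  rw [← hη, ← hc] at h6
  rw [← hη] at h2
  have hρ : 0 < η * μ := by positivity
  have hcρ : c * (η * μ) = 2 * γ * Lb ^ 2 := by rw [hc, div_mul_cancel₀ _ hρ.ne']
  generalize hρd : η * μ = ρ at *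
  generalize trackingEnergy f θstar η δ' (θ + η • h) = W' at *
  generalize trackingEnergy f θstar η δ (θ + η • h) = W₁ at *
  generalize trackingEnergy f θstar η δ θ = W at *
  generalize ‖θ + η • h - θstar δ‖ = d₁ at *
  generalize ‖θ - θstar δ‖ = d₀ at *
  generalize ‖δ' - δ‖ = v at *
  generalize inner ℝ (trackingDirection f θstar η δ θ) (h - gradTheta f δ θ) = I at *
  generalize ‖h - gradTheta f δ θ‖ ^ 2 = J at *
  generalize hq : L12 / μ = q at *
  -- The weight `ρ/2` inflates `W₁` only by `1 + ρ/2`. Since `W ≤ 2 d₀²`, this consumes half of the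
  -- decrease `2ρ d₀²`.
  have young : 4 * q * d₁ * v ≤ ρ / 2 * d₁ ^ 2 + 8 / ρ * q ^ 2 * v ^ 2 := by
    have : ρ / 2 * d₁ ^ 2 + 8 / ρ * q ^ 2 * v ^ 2 - 4 * q * d₁ * v
        = ρ / 2 * (d₁ - 4 / ρ * q * v) ^ 2 := by
      field_simp
      ring
    linarith [mul_nonneg (half_pos hρ).le (sq_nonneg (d₁ - 4 / ρ * q * v))]
  have h7 : W' ≤ (1 + ρ / 2) * W₁
      + ((8 / ρ + 1) * q ^ 2 + 6 * η * smoothConst μ L11 L12) * v ^ 2 := by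
    linarith [mul_le_mul_of_nonneg_left h5 (half_pos hρ).le]
  have h8 : (1 + ρ / 2) * W₁ ≤ W - ρ * d₀ ^ 2 + (1 + ρ / 2) * (I + 2 * η ^ 2 * J) := by
    have := mul_le_mul_of_nonneg_left h3 (by positivity : 0 ≤ 1 + ρ / 2)
    linarith [mul_le_mul_of_nonneg_left h4 (half_pos hρ).le,
      mul_nonneg (sq_nonneg ρ) (sq_nonneg d₀)]
  have h9 := mul_le_mul_of_nonneg_left (h7.trans (add_le_add_left h8 _)) hc0.le
  have h10 := mul_le_mul_of_nonneg_right h6 (sq_nonneg v)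
  -- The choice of `c` makes `cρ = 2γLb²`: one share absorbs the tracking bias in the attacker's
  -- step, the other is the surplus `γ d₀²`.
  have h11 : γ * L12 ^ 2 * d₀ ^ 2 + γ * d₀ ^ 2 ≤ c * ρ * d₀ ^ 2 := by
    rw [hcρ, ← add_mul]
    refine mul_le_mul_of_nonneg_right ?_ (sq_nonneg _)
    have ha : L12 ^ 2 ≤ Lb ^ 2 := by gcongr
    have hb : 1 ≤ Lb ^ 2 := one_le_pow₀ hLb
    nlinarith
  have e1 : 7 / (16 * γ) = 7 / 16 * (1 / γ) := by field_simp
  have e2 : 1 / (16 * γ) = 1 / 16 * (1 / γ) := by field_simp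
  have e3 : 1 / (4 * γ) = 1 / 4 * (1 / γ) := by field_simp
  rw [e1] at h1
  rw [e2] at h10
  rw [e3]
  have h12 : 0 ≤ 1 / γ * v ^ 2 := by positivity
  linarith

/-- The projection inequality controls `g` tested against `x - δ'`. Passing from `δ'` back to `δ`
costs `‖g‖ ‖δ' - δ‖`, hence the product term, with `‖g‖` estimated through `∇Φ`; replacing `g` by
the true gradient costs the noise norm. -/
theorem MinimaxRSI.isFOSP_of_step {Φinf : ℝ} (hR : MinimaxRSI f U μ θstar)
    (hG : LipschitzGradients f U L11 L12 L22) (hΔU : Δ ⊆ U) (hΔ : Convex ℝ Δ) (hγ : 0 < γ)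
    {δ δ' g : Euc n} (hδ : δ ∈ Δ) (hΦ : ‖gradDelta f δ (θstar δ)‖ ≤ Φinf)
    (hp : IsProjection Δ (δ - γ • g) δ') (θ : Euc d) :
    IsFOSP f Δ (1 / γ * ‖δ' - δ‖ + (Φinf + L12 * ‖θ - θstar δ‖ + ‖g - gradDelta f δ θ‖) * ‖δ' - δ‖
      + ‖g - gradDelta f δ θ‖ + L22 * ‖θ - θstar δ‖) δ θ := by
  have hl := hG.lip12 δ (hΔU hδ) θ (θstar δ)
  have ht := hR.norm_gradTheta_le hG (hΔU hδ) θ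
  have h0 : 0 ≤ 1 / γ := by positivity
  constructor
  · intro x hx hx1
    have h1 := hp.inner_step_le hΔ hγ hx
    have h2 : inner ℝ (δ' - δ) (x - δ') ≤ ‖δ' - δ‖ := by
      have e : x - δ' = (x - δ) - (δ' - δ) := by abel
      rw [e, inner_sub_right, real_inner_self_eq_norm_sq]
      have := real_inner_le_norm (δ' - δ) (x - δ)
      nlinarith [norm_nonneg (δ' - δ), sq_nonneg ‖δ' - δ‖]
    have h3 : ‖g‖ ≤ Φinf + L12 * ‖θ - θstar δ‖ + ‖g - gradDelta f δ θ‖ := by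
      have e : g = gradDelta f δ (θstar δ) + (gradDelta f δ θ - gradDelta f δ (θstar δ))
        + (g - gradDelta f δ θ) := by abel
      calc ‖g‖ = _ := congrArg _ e
        _ ≤ _ := norm_add₃_le
        _ ≤ _ := by gcongr
    have h4 := neg_le_of_abs_le (abs_real_inner_le_norm g (δ' - δ))
    have h5 := mul_le_mul_of_nonneg_right h3 (norm_nonneg (δ' - δ))
    have h6 := real_inner_le_norm (g - gradDelta f δ θ) (x - δ)
    have h7 : ‖g - gradDelta f δ θ‖ * ‖x - δ‖ ≤ ‖g - gradDelta f δ θ‖ :=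
      mul_le_of_le_one_right (norm_nonneg _) hx1
    have h8 := mul_le_mul_of_nonneg_left h2 h0
    have h9 : inner ℝ (gradDelta f δ θ) (x - δ)
        = inner ℝ g (δ' - δ) - inner ℝ g (δ' - x) - inner ℝ (g - gradDelta f δ θ) (x - δ) := by
      simp only [inner_sub_left, inner_sub_right]; ring
    have h10 := (norm_nonneg _).trans ht
    linarith
  · intro y hy
    have h1 := real_inner_le_norm (gradTheta f δ θ) (y - θ)
    have h2 : ‖gradTheta f δ θ‖ * ‖y - θ‖ ≤ ‖gradTheta f δ θ‖ :=
      mul_le_of_le_one_right (norm_nonneg _) hy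
    have h3 : 0 ≤ Φinf + L12 * ‖θ - θstar δ‖ + ‖g - gradDelta f δ θ‖ := by
      have := (norm_nonneg _).trans hl
      have := (norm_nonneg _).trans hΦ
      positivity
    have : 0 ≤ 1 / γ * ‖δ' - δ‖ + (Φinf + L12 * ‖θ - θstar δ‖ + ‖g - gradDelta f δ θ‖) * ‖δ' - δ‖
      + ‖g - gradDelta f δ θ‖ := by positivity
    linarith

theorem fospResidual_nonneg (f : Euc n → Euc d → ℝ) (Δ : Set (Euc n)) (δ : Euc n) (θ : Euc d) :
    0 ≤ fospResidual f Δ δ θ :=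
  Real.sInf_nonneg fun _ hr => by simpa using hr.2 θ (by simp)

/-- Quadratic bound on the stationarity residual by the step length, the tracking error and
the noise. -/
theorem MinimaxRSI.fospResidual_le {Φinf ε : ℝ} (hR : MinimaxRSI f U μ θstar)
    (hG : LipschitzGradients f U L11 L12 L22) (hΔU : Δ ⊆ U) (hΔ : Convex ℝ Δ) (hγ : 0 < γ)
    (hL12 : 0 ≤ L12) (hL22 : 0 ≤ L22) (hε : 0 < ε) (hε1 : ε ≤ 1)
    {δ δ' g : Euc n} (hδ : δ ∈ Δ) (hΦ : ‖gradDelta f δ (θstar δ)‖ ≤ Φinf)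
    (hp : IsProjection Δ (δ - γ • g) δ') (θ : Euc d) :
    fospResidual f Δ δ θ ≤ ε / 2 + (3 / 2 * (1 / γ + Φinf + 1 + L22) ^ 2 + L12 + 1) / ε
      * (‖δ' - δ‖ ^ 2 + ‖θ - θstar δ‖ ^ 2 + ‖g - gradDelta f δ θ‖ ^ 2) := by
  refine ((isFOSP_iff_fospResidual_le _ _ _ _ _).1
    (hR.isFOSP_of_step hG hΔU hΔ hγ hδ hΦ hp θ)).trans ?_
  have hΦ0 := (norm_nonneg _).trans hΦ
  have h0 : 0 < 1 / γ := by positivity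
  have hv := norm_nonneg (δ' - δ)
  have hd := norm_nonneg (θ - θstar δ)
  have he := norm_nonneg (g - gradDelta f δ θ)
  generalize ‖δ' - δ‖ = v at *
  generalize ‖θ - θstar δ‖ = t at *
  generalize ‖g - gradDelta f δ θ‖ = e at *
  generalize 1 / γ = k at *
  -- A common coefficient for the linear terms in `v`, `e` and `t`; each costs `ε/6` in Young's
  -- inequality. The products are already quadratic and are absorbed using `ε ≤ 1`.
  obtain ⟨A, hA⟩ : ∃ A, A = k + Φinf + 1 + L22 := ⟨_, rfl⟩
  rw [← hA]
  have young : ∀ a : ℝ, A * a ≤ ε / 6 + 3 / 2 * A ^ 2 / ε * a ^ 2 := fun a => by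
    have : ε / 6 + 3 / 2 * A ^ 2 / ε * a ^ 2 - A * a
        = 1 / (6 * ε) * (ε - 3 * A * a) ^ 2 := by
      field_simp
      ring
    have h : 0 ≤ 1 / (6 * ε) * (ε - 3 * A * a) ^ 2 := by positivity
    linarith
  have h1 : (k + Φinf) * v ≤ A * v := by gcongr; linarith
  have h2 : e ≤ A * e := le_mul_of_one_le_left he (by linarith)
  have h3 : L22 * t ≤ A * t := by gcongr; linarith
  have h4 : L12 * t * v ≤ L12 * (v ^ 2 + t ^ 2 + e ^ 2) := by
    rw [mul_assoc]; gcongr; nlinarith [sq_nonneg (t - v)]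
  have h5 : e * v ≤ v ^ 2 + t ^ 2 + e ^ 2 := by nlinarith [sq_nonneg (e - v)]
  have h6 : (L12 + 1) * (v ^ 2 + t ^ 2 + e ^ 2) ≤ (L12 + 1) / ε * (v ^ 2 + t ^ 2 + e ^ 2) := by
    gcongr
    exact le_div_self (by positivity) hε hε1
  have h7 : (3 / 2 * A ^ 2 + L12 + 1) / ε = 3 / 2 * A ^ 2 / ε + (L12 + 1) / ε := by
    rw [add_assoc, add_div]
  rw [h7]
  linarith [young v, young e, young t]

/-! ### Measurability of the stationarity residual. -/

/-- `y ↦ ⟨G, y - x⟩` exceeding a level within the unit ball of a convex set is an open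
condition on `(G, x)`. -/
theorem isOpen_setOf_exists_inner_gt {T E : Type*} [TopologicalSpace T] [NormedAddCommGroup E]
    [InnerProductSpace ℝ E] {C : Set E} (hC : Convex ℝ C) {G x : T → E} (hG : Continuous G)
    (hx : Continuous x) (hxC : ∀ τ, x τ ∈ C) (ε : ℝ) :
    IsOpen {τ | ∃ y ∈ C, ‖y - x τ‖ ≤ 1 ∧ ε < inner ℝ (G τ) (y - x τ)} := by
  have : {τ | ∃ y ∈ C, ‖y - x τ‖ ≤ 1 ∧ ε < inner ℝ (G τ) (y - x τ)}
      = ⋃ y ∈ C, {τ | ‖y - x τ‖ < 1 ∧ ε < inner ℝ (G τ) (y - x τ)} := by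
    ext τ
    simp only [Set.mem_ofPred_eq, Set.mem_iUnion, exists_prop]
    constructor
    · rintro ⟨y, hy, h1, h2⟩
      -- Shrinking `y` slightly towards `x τ` stays in `C`, makes the norm bound strict and keeps
      -- the strict inner product bound. With strict bounds and `y` fixed, the condition is open.
      have hcont : Continuous fun s : ℝ => s * inner ℝ (G τ) (y - x τ) := by fun_prop
      have hev : ∀ᶠ s in nhdsWithin (1 : ℝ) (Set.Iio 1), ε < s * inner ℝ (G τ) (y - x τ) := by
        have := (hcont.tendsto 1).eventually_const_lt (u := ε) (by simpa using h2)
        exact this.filter_mono nhdsWithin_le_nhds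
      have hev2 : ∀ᶠ s in nhdsWithin (1 : ℝ) (Set.Iio 1), 0 < s :=
        ((lt_mem_nhds zero_lt_one).filter_mono nhdsWithin_le_nhds)
      obtain ⟨s, hs, hs0, hs1⟩ := (hev.and (hev2.and self_mem_nhdsWithin)).exists
      have e : x τ + s • (y - x τ) - x τ = s • (y - x τ) := by abel
      refine ⟨x τ + s • (y - x τ), hC.add_smul_sub_mem (hxC τ) hy ⟨hs0.le, (le_of_lt hs1)⟩, ?_, ?_⟩
      · rw [e, norm_smul, Real.norm_of_nonneg hs0.le]
        exact (mul_le_of_le_one_right hs0.le h1).trans_lt hs1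
      · rwa [e, real_inner_smul_right]
    · rintro ⟨y, hy, h1, h2⟩
      exact ⟨y, hy, h1.le, h2⟩
  rw [this]
  refine isOpen_biUnion fun y _ => ?_
  have h1 : Continuous fun τ => y - x τ := continuous_const.sub hx
  have h2 : Continuous fun τ => inner ℝ (G τ) (y - x τ) := hG.inner h1
  exact (isOpen_lt h1.norm continuous_const).inter (isOpen_lt continuous_const h2)

/-- The subtype `S` matters because the regularity of `f`, and so the openness, is known only over
the feasible set. -/
theorem measurable_comp_of_isOpen_lt {X Y Ω : Type*} [TopologicalSpace X] [MeasurableSpace X]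
    [BorelSpace X] [SecondCountableTopology X] [TopologicalSpace Y] [MeasurableSpace Y]
    [BorelSpace Y] [SecondCountableTopology Y] [MeasurableSpace Ω] {S : Set X} {r : X → Y → ℝ}
    (h : ∀ ε, IsOpen {p : S × Y | ε < r p.1 p.2}) {x : Ω → X} {y : Ω → Y} (hx : Measurable x)
    (hy : Measurable y) (hmem : ∀ ω, x ω ∈ S) : Measurable fun ω => r (x ω) (y ω) := by
  have hr : Measurable fun p : S × Y => r p.1 p.2 :=
    measurable_of_Ioi fun ε => (h ε).measurableSet
  exact hr.comp ((hx.subtype_mk (h := hmem)).prodMk hy)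

theorem isOpen_setOf_exists_inner_gt_or {E F : Type*} [NormedAddCommGroup E]
    [InnerProductSpace ℝ E] [NormedAddCommGroup F] [InnerProductSpace ℝ F] {C : Set E}
    (hC : Convex ℝ C) {G : C × F → E} {H : C × F → F} (hG : Continuous G) (hH : Continuous H)
    (ε : ℝ) : IsOpen {p : C × F | (∃ y ∈ C, ‖y - p.1‖ ≤ 1 ∧ ε < inner ℝ (G p) (y - p.1)) ∨
      (∃ y ∈ (Set.univ : Set F), ‖y - p.2‖ ≤ 1 ∧ ε < inner ℝ (H p) (y - p.2))} :=
  (isOpen_setOf_exists_inner_gt hC hG (continuous_subtype_val.comp continuous_fst)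
    (fun p => p.1.2) ε).union
    (isOpen_setOf_exists_inner_gt convex_univ hH continuous_snd (fun _ => trivial) ε)

theorem lt_fospResidual_iff (ε : ℝ) (δ : Euc n) (θ : Euc d) :
    ε < fospResidual f Δ δ θ ↔
      (∃ y ∈ Δ, ‖y - δ‖ ≤ 1 ∧ ε < inner ℝ (-gradDelta f δ θ) (y - δ)) ∨
      (∃ y ∈ (Set.univ : Set (Euc d)), ‖y - θ‖ ≤ 1 ∧ ε < inner ℝ (gradTheta f δ θ) (y - θ)) := by
  rw [← not_le, ← isFOSP_iff_fospResidual_le, IsFOSP, not_and_or]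
  push Not
  simp only [inner_neg_left, lt_neg, Set.mem_univ, true_and]

theorem LipschitzGradients.isOpen_lt_fospResidual (hG : LipschitzGradients f U L11 L12 L22)
    (hL11 : 0 ≤ L11) (hL12 : 0 ≤ L12) (hL22 : 0 ≤ L22) (hΔU : Δ ⊆ U) (hΔ : Convex ℝ Δ) (ε : ℝ) :
    IsOpen {p : Δ × Euc d | ε < fospResidual f Δ p.1 p.2} := by
  have hm : Continuous fun p : Δ × Euc d => ((p.1 : Euc n), p.2) := by fun_prop
  have c1 : Continuous fun p : Δ × Euc d => -gradDelta f p.1 p.2 :=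
    ((hG.continuousOn_gradDelta hL11 hL12).comp_continuous hm
      fun p => ⟨hΔU p.1.2, trivial⟩).neg
  have c2 : Continuous fun p : Δ × Euc d => gradTheta f p.1 p.2 :=
    (hG.continuousOn_gradTheta hL22 hL12).comp_continuous hm fun p => ⟨hΔU p.1.2, trivial⟩
  simp only [lt_fospResidual_iff]
  exact isOpen_setOf_exists_inner_gt_or hΔ c1 c2 ε

theorem LipschitzGradients.measurable_fospResidual (hG : LipschitzGradients f U L11 L12 L22)
    (hL11 : 0 ≤ L11) (hL12 : 0 ≤ L12) (hL22 : 0 ≤ L22) (hΔU : Δ ⊆ U) (hΔ : Convex ℝ Δ)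
    {Ω : Type*} [MeasurableSpace Ω] {δ : Ω → Euc n} {θ : Ω → Euc d} (hδ : Measurable δ)
    (hθ : Measurable θ) (hmem : ∀ ω, δ ω ∈ Δ) :
    Measurable fun ω => fospResidual f Δ (δ ω) (θ ω) :=
  measurable_comp_of_isOpen_lt (r := fospResidual f Δ)
    (hG.isOpen_lt_fospResidual hL11 hL12 hL22 hΔU hΔ) hδ hθ hmem

end Steps

end

/-! ### Expectations through the sampling kernel, and telescoping. -/

noncomputable section

section Law

variable {X Ξ Ω : Type*} [MeasurableSpace X] [MeasurableSpace Ξ] [MeasurableSpace Ω]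
  {P : Measure Ω} [IsProbabilityMeasure P] {K : Kernel X Ξ} [IsMarkovKernel K]
  {Z : Ω → X} {ξ : Ω → Ξ} {S : Set X}

/-- A nonnegative function of state and sample with uniformly bounded conditional mean is
integrable, with the same bound on its mean. -/
theorem integrable_and_integral_le_of_law (hZ : Measurable Z) (hξ : Measurable ξ)
    (law : P.map (fun ω => (Z ω, ξ ω)) = P.map Z ⊗ₘ K) (hS : MeasurableSet S)
    (hZS : ∀ ω, Z ω ∈ S) {F : X × Ξ → ℝ} (hF : Measurable F) (hF0 : ∀ p, 0 ≤ F p) {v : ℝ}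
    (hint : ∀ x ∈ S, Integrable (fun s => F (x, s)) (K x))
    (hle : ∀ x ∈ S, ∫ s, F (x, s) ∂(K x) ≤ v) :
    Integrable (fun ω => F (Z ω, ξ ω)) P ∧ ∫ ω, F (Z ω, ξ ω) ∂P ≤ v := by
  have hp : IsProbabilityMeasure (P.map Z) := Measure.isProbabilityMeasure_map hZ.aemeasurable
  have hae : ∀ᵐ x ∂(P.map Z), x ∈ S :=
    (ae_map_iff hZ.aemeasurable hS).2 (Filter.Eventually.of_forall hZS)
  have hm : AEMeasurable (fun ω => (Z ω, ξ ω)) P := (hZ.prodMk hξ).aemeasurable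
  have hmeas : Measurable fun x => ∫ s, F (x, s) ∂(K x) :=
    (hF.stronglyMeasurable.integral_kernel_prod_right').measurable
  have hb : ∀ᵐ x ∂(P.map Z), ‖∫ s, F (x, s) ∂(K x)‖ ≤ v := by
    filter_upwards [hae] with x hx
    rw [Real.norm_of_nonneg (integral_nonneg fun s => hF0 _)]
    exact hle x hx
  have hi : Integrable F (P.map Z ⊗ₘ K) := by
    rw [Measure.integrable_compProd_iff hF.aestronglyMeasurable]
    refine ⟨hae.mono hint, ?_⟩
    simp only [Real.norm_of_nonneg (hF0 _)]
    exact Integrable.of_bound hmeas.aestronglyMeasurable v hb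
  have hi' : Integrable (fun ω => F (Z ω, ξ ω)) P := by
    rw [← law] at hi
    exact hi.comp_aemeasurable hm
  refine ⟨hi', ?_⟩
  calc ∫ ω, F (Z ω, ξ ω) ∂P = ∫ p, F p ∂(P.map Z ⊗ₘ K) := by
        rw [← law, integral_map hm hF.aestronglyMeasurable]
    _ = ∫ x, ∫ s, F (x, s) ∂(K x) ∂(P.map Z) := Measure.integral_compProd hi
    _ ≤ ∫ _, v ∂(P.map Z) := integral_mono_ae
        (Integrable.of_bound hmeas.aestronglyMeasurable v hb) (integrable_const v)
        (by filter_upwards [hae] with x hx using hle x hx)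
    _ = v := by simp

/-- Conditionally centred noise is uncorrelated with every function of the state. -/
theorem integral_inner_eq_zero_of_law {H : Type*} [NormedAddCommGroup H] [InnerProductSpace ℝ H]
    [CompleteSpace H] [MeasurableSpace H] [BorelSpace H] [SecondCountableTopology H]
    (hZ : Measurable Z) (hξ : Measurable ξ)
    (law : P.map (fun ω => (Z ω, ξ ω)) = P.map Z ⊗ₘ K) (hS : MeasurableSet S)
    (hZS : ∀ ω, Z ω ∈ S) {u : X → H} {q : X × Ξ → H} (hu : Measurable u) (hq : Measurable q)
    (hint : ∀ x ∈ S, Integrable (fun s => q (x, s)) (K x))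
    (hzero : ∀ x ∈ S, ∫ s, q (x, s) ∂(K x) = 0)
    (hi : Integrable (fun ω => inner ℝ (u (Z ω)) (q (Z ω, ξ ω))) P) :
    ∫ ω, inner ℝ (u (Z ω)) (q (Z ω, ξ ω)) ∂P = 0 := by
  have hae : ∀ᵐ x ∂(P.map Z), x ∈ S :=
    (ae_map_iff hZ.aemeasurable hS).2 (Filter.Eventually.of_forall hZS)
  have hp : IsProbabilityMeasure (P.map Z) := Measure.isProbabilityMeasure_map hZ.aemeasurable
  have hm : AEMeasurable (fun ω => (Z ω, ξ ω)) P := (hZ.prodMk hξ).aemeasurable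
  have hF : Measurable fun p : X × Ξ => inner ℝ (u p.1) (q p) :=
    (hu.comp measurable_fst).inner hq
  have hi' : Integrable (fun p : X × Ξ => inner ℝ (u p.1) (q p)) (P.map Z ⊗ₘ K) := by
    rw [← law]
    exact (integrable_map_measure hF.aestronglyMeasurable hm).2 hi
  calc ∫ ω, inner ℝ (u (Z ω)) (q (Z ω, ξ ω)) ∂P
      = ∫ p, inner ℝ (u p.1) (q p) ∂(P.map Z ⊗ₘ K) := by
        rw [← law, integral_map hm hF.aestronglyMeasurable]
    _ = ∫ x, ∫ s, inner ℝ (u x) (q (x, s)) ∂(K x) ∂(P.map Z) := Measure.integral_compProd hi'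
    _ = ∫ _, (0 : ℝ) ∂(P.map Z) := by
        refine integral_congr_ae ?_
        filter_upwards [hae] with x hx
        rw [integral_inner (hint x hx), hzero x hx, inner_zero_right]
    _ = 0 := by simp

end Law

/-- Telescoping: some increment is at most the average. -/
theorem exists_lt_le_of_telescoping {a x : ℕ → ℝ} {b : ℝ} {N : ℕ} (hN : 0 < N)
    (ha : 0 ≤ a N) (h : ∀ t < N, a (t + 1) + x t ≤ a t + b) :
    ∃ t < N, x t ≤ a 0 / N + b := by
  by_contra! hcon
  -- This is an equality at `t = 0`, so the induction is not strict; the last step supplies the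
  -- strictness that forces `a N < 0`.
  have h1 : ∀ t ≤ N, a t + t * (a 0 / N) ≤ a 0 := by
    intro t
    induction t with
    | zero => simp
    | succ t ih =>
      intro ht
      have := ih (by omega)
      have h2 := h t (by omega)
      have h3 := hcon t (by omega)
      push_cast
      linarith
  have hN' : (0 : ℝ) < N := by exact_mod_cast hN
  have h2 : ∀ t < N, a (t + 1) < a t - a 0 / N := fun t ht => by
    linarith [h t ht, hcon t ht]
  obtain ⟨k, rfl⟩ : ∃ k, N = k + 1 := ⟨N - 1, by omega⟩
  have h3 := h1 k (by omega)
  have h4 := h2 k (by omega)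
  have h5 : ((k : ℝ) + 1) * (a 0 / ((k + 1 : ℕ) : ℝ)) = a 0 := by
    push_cast at hN' ⊢
    rw [mul_div_cancel₀ _ hN'.ne']
  linarith

/-! ### Noise moments along a run. -/

section Run

variable {n d : ℕ} {f : Euc n → Euc d → ℝ} {U Δ : Set (Euc n)} {μ L11 L12 L22 : ℝ}
  {θstar : Euc n → Euc d} {Ξ Ω : Type*} [MeasurableSpace Ξ] [MeasurableSpace Ω]
  {K : Kernel (Euc n × Euc d) Ξ} {gδ : Euc n → Euc d → Ξ → Euc n}
  {gθ : Euc n → Euc d → Ξ → Euc d} {σ η₁ η₂ : ℝ} {M N : ℕ} {P : Measure Ω}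
  {δ₀ : Euc n} {θ₀ : Euc d} {ξ : ℕ → Ω → Ξ} {δ : ℕ → Ω → Euc n} {θ : ℕ → Ω → Euc d}

theorem IsPersistentAttack.mem (hA : IsPersistentAttack P Δ K gδ gθ η₁ η₂ δ₀ θ₀ N ξ δ θ)
    (hδ₀ : δ₀ ∈ Δ) {t : ℕ} (ht : t ≤ N) (ω : Ω) : δ t ω ∈ Δ := by
  cases t with
  | zero => rw [hA.init_δ]; exact hδ₀
  | succ t => exact (hA.step_δ t ht ω).1

/-- The kernel lemmas need measurability on the whole state space, while the gradients are
controlled only over `U`. Extension by zero changes nothing along a run, which stays in `Δ`. -/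
theorem measurable_piecewise_of_continuousOn {H : Type*} [NormedAddCommGroup H]
    [MeasurableSpace H] [BorelSpace H] {m : Euc n × Euc d → H} (hΔU : Δ ⊆ U)
    (hΔ : IsClosed Δ) (hm : ContinuousOn m (U ×ˢ Set.univ))
    [∀ p, Decidable (p ∈ Δ ×ˢ (Set.univ : Set (Euc d)))] :
    Measurable ((Δ ×ˢ (Set.univ : Set (Euc d))).piecewise m 0) :=
  (hm.mono (Set.prod_mono hΔU le_rfl)).measurable_piecewise continuousOn_const
    (hΔ.prod isClosed_univ).measurableSet

theorem ContinuousOn.measurable_comp_of_mem {H X : Type*} [TopologicalSpace X]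
    [MeasurableSpace X] [BorelSpace X] [TopologicalSpace H]
    [MeasurableSpace H] [BorelSpace H] {S : Set X} {m : X → H} (hm : ContinuousOn m S)
    {Z : Ω → X} (hZ : Measurable Z) (hmem : ∀ ω, Z ω ∈ S) : Measurable fun ω => m (Z ω) := by
  have h1 : Measurable fun p : S => m p := hm.domRestrict.measurable
  have h2 : Measurable fun ω => (⟨Z ω, hmem ω⟩ : S) := hZ.subtype_mk
  exact h1.comp h2

theorem MinimaxRSI.continuousOn_trackingDirection (hR : MinimaxRSI f U μ θstar)
    (hG : LipschitzGradients f U L11 L12 L22) (hμ : 0 < μ) (hL12 : 0 ≤ L12) (hL22 : 0 ≤ L22)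
    (η : ℝ) : ContinuousOn (fun p : Euc n × Euc d => trackingDirection f θstar η p.1 p.2)
      (U ×ˢ Set.univ) := by
  have h1 : ContinuousOn (fun p : Euc n × Euc d => θstar p.1) (U ×ˢ Set.univ) :=
    (hR.continuousOn_thetaStar hG hμ hL12).comp continuousOn_fst fun p hp => hp.1
  have h2 := hG.continuousOn_gradTheta hL22 hL12
  have h3 : ContinuousOn (fun p : Euc n × Euc d => (2 * η) • (p.2 - θstar p.1))
      (U ×ˢ Set.univ) := (continuousOn_snd.sub h1).const_smul (2 * η)
  have h4 : ContinuousOn (fun p : Euc n × Euc d => (2 * η ^ 2) • gradTheta f p.1 p.2)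
      (U ×ˢ Set.univ) := h2.const_smul (2 * η ^ 2)
  exact h3.add h4

theorem MinimaxRSI.continuousOn_trackingEnergy (hR : MinimaxRSI f U μ θstar)
    (hG : LipschitzGradients f U L11 L12 L22) (hU : IsOpen U) (hμ : 0 < μ) (hL12 : 0 ≤ L12)
    (η : ℝ) : ContinuousOn (fun p : Euc n × Euc d => trackingEnergy f θstar η p.1 p.2)
      (U ×ˢ Set.univ) := by
  have h1 : ContinuousOn (fun p : Euc n × Euc d => θstar p.1) (U ×ˢ Set.univ) :=
    (hR.continuousOn_thetaStar hG hμ hL12).comp continuousOn_fst fun p hp => hp.1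
  have h2 : ContinuousOn (fun p : Euc n × Euc d => valueFn f p.1) (U ×ˢ Set.univ) :=
    (hR.continuousOn_valueFn hG hμ hL12 hU).comp continuousOn_fst fun p hp => hp.1
  unfold trackingEnergy
  exact ((continuousOn_snd.sub h1).norm.pow 2).add
    (continuousOn_const.mul (h2.sub hG.contDiff.continuousOn))

theorem IsPersistentAttack.integral_noise_le [IsProbabilityMeasure P] [IsMarkovKernel K]
    (hA : IsPersistentAttack P Δ K gδ gθ η₁ η₂ δ₀ θ₀ N ξ δ θ)
    (hSG : StochasticGradients f Δ K gδ gθ σ M)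
    (hG : LipschitzGradients f U L11 L12 L22) (hL11 : 0 ≤ L11) (hL12 : 0 ≤ L12)
    (hL22 : 0 ≤ L22) (hΔU : Δ ⊆ U) (hΔ : IsClosed Δ) (hδ₀ : δ₀ ∈ Δ) {t : ℕ} (ht : t < N) :
    Integrable (fun ω => ‖gδ (δ t ω) (θ t ω) (ξ t ω) - gradDelta f (δ t ω) (θ t ω)‖ ^ 2
      + ‖gθ (δ t ω) (θ t ω) (ξ t ω) - gradTheta f (δ t ω) (θ t ω)‖ ^ 2) P ∧
    ∫ ω, (‖gδ (δ t ω) (θ t ω) (ξ t ω) - gradDelta f (δ t ω) (θ t ω)‖ ^ 2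
      + ‖gθ (δ t ω) (θ t ω) (ξ t ω) - gradTheta f (δ t ω) (θ t ω)‖ ^ 2) ∂P ≤ σ ^ 2 / M := by
  classical
  have mδ := measurable_piecewise_of_continuousOn hΔU hΔ (hG.continuousOn_gradDelta hL11 hL12)
  have mθ := measurable_piecewise_of_continuousOn hΔU hΔ (hG.continuousOn_gradTheta hL22 hL12)
  have hS : MeasurableSet (Δ ×ˢ (Set.univ : Set (Euc d))) := (hΔ.prod isClosed_univ).measurableSet
  have hZS : ∀ ω, (δ t ω, θ t ω) ∈ Δ ×ˢ (Set.univ : Set (Euc d)) :=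
    fun ω => ⟨hA.mem hδ₀ ht.le ω, trivial⟩
  have hF : Measurable fun p : (Euc n × Euc d) × Ξ =>
      ‖gδ p.1.1 p.1.2 p.2 - (Δ ×ˢ (Set.univ : Set (Euc d))).piecewise
        (fun q => gradDelta f q.1 q.2) 0 p.1‖ ^ 2
      + ‖gθ p.1.1 p.1.2 p.2 - (Δ ×ˢ (Set.univ : Set (Euc d))).piecewise
        (fun q => gradTheta f q.1 q.2) 0 p.1‖ ^ 2 :=
    ((hSG.measurable_gδ.sub (mδ.comp measurable_fst)).norm.pow_const 2).add
      ((hSG.measurable_gθ.sub (mθ.comp measurable_fst)).norm.pow_const 2)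
  have key := integrable_and_integral_le_of_law ((hA.measurable_δ t ht.le).prodMk
    (hA.measurable_θ t ht.le)) (hA.measurable_ξ t ht) (hA.law t ht) hS hZS hF
    (fun p => by positivity) (v := σ ^ 2 / M)
    (fun x hx => by
      simp only [Set.piecewise_eq_of_mem _ _ _ hx]
      exact hSG.integrable_sq x.1 hx.1 x.2)
    (fun x hx => by
      simp only [Set.piecewise_eq_of_mem _ _ _ hx]
      exact hSG.variance_le x.1 hx.1 x.2)
  simpa only [Set.piecewise_eq_of_mem _ _ _ (hZS _)] using key

theorem IsPersistentAttack.integral_inner_noise_eq_zero [IsProbabilityMeasure P]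
    [IsMarkovKernel K]
    (hA : IsPersistentAttack P Δ K gδ gθ η₁ η₂ δ₀ θ₀ N ξ δ θ)
    (hSG : StochasticGradients f Δ K gδ gθ σ M)
    (hG : LipschitzGradients f U L11 L12 L22) (hL12 : 0 ≤ L12)
    (hL22 : 0 ≤ L22) (hΔU : Δ ⊆ U) (hΔ : IsClosed Δ) (hδ₀ : δ₀ ∈ Δ)
    {u : Euc n × Euc d → Euc d} (hu : ContinuousOn u (U ×ˢ Set.univ)) {t : ℕ} (ht : t < N)
    (hi : Integrable (fun ω => inner ℝ (u (δ t ω, θ t ω))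
      (gθ (δ t ω) (θ t ω) (ξ t ω) - gradTheta f (δ t ω) (θ t ω))) P) :
    ∫ ω, inner ℝ (u (δ t ω, θ t ω))
      (gθ (δ t ω) (θ t ω) (ξ t ω) - gradTheta f (δ t ω) (θ t ω)) ∂P = 0 := by
  classical
  have mθ := measurable_piecewise_of_continuousOn hΔU hΔ (hG.continuousOn_gradTheta hL22 hL12)
  have mv := measurable_piecewise_of_continuousOn hΔU hΔ hu
  have hS : MeasurableSet (Δ ×ˢ (Set.univ : Set (Euc d))) := (hΔ.prod isClosed_univ).measurableSet
  have hZS : ∀ ω, (δ t ω, θ t ω) ∈ Δ ×ˢ (Set.univ : Set (Euc d)) :=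
    fun ω => ⟨hA.mem hδ₀ ht.le ω, trivial⟩
  have hq : Measurable fun p : (Euc n × Euc d) × Ξ =>
      gθ p.1.1 p.1.2 p.2 - (Δ ×ˢ (Set.univ : Set (Euc d))).piecewise
        (fun q => gradTheta f q.1 q.2) 0 p.1 :=
    hSG.measurable_gθ.sub (mθ.comp measurable_fst)
  have key := integral_inner_eq_zero_of_law ((hA.measurable_δ t ht.le).prodMk
    (hA.measurable_θ t ht.le)) (hA.measurable_ξ t ht) (hA.law t ht) hS hZS mv hq
    (fun x hx => by
      simp only [Set.piecewise_eq_of_mem _ _ _ hx]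
      exact (hSG.integrable_gθ x.1 hx.1 x.2).sub (integrable_const _))
    (fun x hx => by
      simp only [Set.piecewise_eq_of_mem _ _ _ hx]
      rw [integral_sub (hSG.integrable_gθ x.1 hx.1 x.2) (integrable_const _),
        hSG.unbiased_gθ x.1 hx.1 x.2]
      simp)
  simp only [Set.piecewise_eq_of_mem _ _ _ (hZS _)] at key
  exact key hi

end Run

end

/-! ### Expected energy decrease. -/

noncomputable section

/-- Nonnegative Lyapunov function of Persistent Attack. -/
def attackEnergy {n d : ℕ} (f : Euc n → Euc d → ℝ) (Δ : Set (Euc n)) (θstar : Euc n → Euc d)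
    (η c : ℝ) (δ : Euc n) (θ : Euc d) : ℝ :=
  valueFn f δ - sInf (valueFn f '' Δ) + c * trackingEnergy f θstar η δ θ

/-- Squared step of the attacker and squared tracking error of the learner, weighted by the
attacker's step size. -/
def attackProgress {n d : ℕ} (θstar : Euc n → Euc d) (γ : ℝ) (δ δ' : Euc n) (θ : Euc d) : ℝ :=
  1 / (4 * γ) * ‖δ' - δ‖ ^ 2 + γ * ‖θ - θstar δ‖ ^ 2

section Run

variable {n d : ℕ} {f : Euc n → Euc d → ℝ} {U Δ : Set (Euc n)} {μ L11 L12 L22 η c γ : ℝ}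
  {θstar : Euc n → Euc d} {Ξ Ω : Type*} [MeasurableSpace Ξ] [MeasurableSpace Ω]
  {K : Kernel (Euc n × Euc d) Ξ} {gδ : Euc n → Euc d → Ξ → Euc n}
  {gθ : Euc n → Euc d → Ξ → Euc d} {σ : ℝ} {M N : ℕ} {P : Measure Ω}
  {δ₀ : Euc n} {θ₀ : Euc d} {ξ : ℕ → Ω → Ξ} {δ : ℕ → Ω → Euc n} {θ : ℕ → Ω → Euc d}

/-- Yields nonnegativity of the energy, and lets its integrability control the second moment of the
tracking error. -/
theorem MinimaxRSI.mul_sq_le_attackEnergy (hR : MinimaxRSI f U μ θstar)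
    (hG : LipschitzGradients f U L11 L12 L22) (hU : IsOpen U) (hμ : 0 < μ) (hL12 : 0 ≤ L12)
    (hΔU : Δ ⊆ U) (hΔ : IsCompact Δ) (hη : 0 ≤ η) (hc : 0 ≤ c) {δ : Euc n} (hδ : δ ∈ Δ)
    (θ : Euc d) : c * ‖θ - θstar δ‖ ^ 2 ≤ attackEnergy f Δ θstar η c δ θ := by
  have h1 := csInf_le (hΔ.bddBelow_image ((hR.continuousOn_valueFn hG hμ hL12 hU).mono hΔU))
    (Set.mem_image_of_mem (valueFn f) hδ)
  have h2 := mul_le_mul_of_nonneg_left (hR.sq_le_trackingEnergy hη (hΔU hδ) θ) hc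
  unfold attackEnergy
  linarith

theorem attackProgress_nonneg (θstar : Euc n → Euc d) (hγ : 0 ≤ γ) (δ δ' : Euc n) (θ : Euc d) :
    0 ≤ attackProgress θstar γ δ δ' θ := by
  unfold attackProgress
  positivity

theorem MinimaxRSI.norm_trackingDirection_le (hR : MinimaxRSI f U μ θstar)
    (hG : LipschitzGradients f U L11 L12 L22) (hη : 0 ≤ η) {δ : Euc n} (hδ : δ ∈ U)
    (θ : Euc d) : ‖trackingDirection f θstar η δ θ‖
      ≤ (2 * η + 2 * η ^ 2 * L22) * ‖θ - θstar δ‖ := by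
  unfold trackingDirection
  refine (norm_add_le _ _).trans ?_
  rw [norm_smul, norm_smul, Real.norm_of_nonneg (by positivity),
    Real.norm_of_nonneg (by positivity)]
  have := mul_le_mul_of_nonneg_left (hR.norm_gradTheta_le hG hδ θ)
    (by positivity : 0 ≤ 2 * η ^ 2)
  linarith

theorem measurable_comp_of_continuousOn_prod {X Y H : Type*} [TopologicalSpace X]
    [MeasurableSpace X] [BorelSpace X] [SecondCountableTopology X] [TopologicalSpace Y]
    [MeasurableSpace Y] [BorelSpace Y] [SecondCountableTopology Y] [TopologicalSpace H]
    [MeasurableSpace H] [BorelSpace H] {S : Set X} {r : X → Y → H}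
    (hr : ContinuousOn (fun p : X × Y => r p.1 p.2) (S ×ˢ Set.univ)) {x : Ω → X} {y : Ω → Y}
    (hx : Measurable x) (hy : Measurable y) (hmem : ∀ ω, x ω ∈ S) :
    Measurable fun ω => r (x ω) (y ω) :=
  hr.measurable_comp_of_mem (Z := fun ω => (x ω, y ω)) (hx.prodMk hy) fun ω => ⟨hmem ω, trivial⟩

/-- Expected decrease of the energy in one step of Persistent Attack. -/
theorem IsPersistentAttack.energy_expectation_step [IsProbabilityMeasure P] [IsMarkovKernel K]
    (hA : IsPersistentAttack P Δ K gδ gθ η γ δ₀ θ₀ N ξ δ θ)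
    (hSG : StochasticGradients f Δ K gδ gθ σ M) (hR : MinimaxRSI f U μ θstar)
    (hG : LipschitzGradients f U L11 L12 L22) (hU : IsOpen U) (hμ : 0 < μ)
    (hL11 : 0 ≤ L11) (hL12 : 0 ≤ L12) (hL22 : 0 ≤ L22) (hΔU : Δ ⊆ U)
    (hΔ : IsCompact Δ) (hδ₀ : δ₀ ∈ Δ) (hη : 0 ≤ η) (hγ : 0 < γ) (hc : 0 < c) {k : ℝ}
    (hk : 0 ≤ k)
    (hstep : ∀ t < N, ∀ ω, valueFn f (δ (t + 1) ω)
        + c * trackingEnergy f θstar η (δ (t + 1) ω) (θ (t + 1) ω)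
        + 1 / (4 * γ) * ‖δ (t + 1) ω - δ t ω‖ ^ 2 + γ * ‖θ t ω - θstar (δ t ω)‖ ^ 2
      ≤ valueFn f (δ t ω) + c * trackingEnergy f θstar η (δ t ω) (θ t ω)
        + γ * ‖gδ (δ t ω) (θ t ω) (ξ t ω) - gradDelta f (δ t ω) (θ t ω)‖ ^ 2
        + k * inner ℝ (trackingDirection f θstar η (δ t ω) (θ t ω))
          (gθ (δ t ω) (θ t ω) (ξ t ω) - gradTheta f (δ t ω) (θ t ω))
        + k * (2 * η ^ 2) * ‖gθ (δ t ω) (θ t ω) (ξ t ω) - gradTheta f (δ t ω) (θ t ω)‖ ^ 2)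
    {t : ℕ} (ht : t < N)
    (hi : Integrable (fun ω => attackEnergy f Δ θstar η c (δ t ω) (θ t ω)) P) :
    Integrable (fun ω => attackEnergy f Δ θstar η c (δ (t + 1) ω) (θ (t + 1) ω)) P ∧
    Integrable (fun ω => attackProgress θstar γ (δ t ω) (δ (t + 1) ω) (θ t ω)) P ∧
    ∫ ω, attackEnergy f Δ θstar η c (δ (t + 1) ω) (θ (t + 1) ω) ∂P
      + ∫ ω, attackProgress θstar γ (δ t ω) (δ (t + 1) ω) (θ t ω) ∂P
      ≤ ∫ ω, attackEnergy f Δ θstar η c (δ t ω) (θ t ω) ∂P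
        + (γ + k * (2 * η ^ 2)) * (σ ^ 2 / M) := by
  obtain ⟨hn, hnle⟩ := hA.integral_noise_le hSG hG hL11 hL12 hL22 hΔU hΔ.isClosed hδ₀ ht
  have hmem : ∀ s ≤ N, ∀ ω, δ s ω ∈ U := fun s hs ω => hΔU (hA.mem hδ₀ hs ω)
  have mW : ∀ s ≤ N, Measurable fun ω => trackingEnergy f θstar η (δ s ω) (θ s ω) :=
    fun s hs => measurable_comp_of_continuousOn_prod (r := trackingEnergy f θstar η)
      (hR.continuousOn_trackingEnergy hG hU hμ hL12 η) (hA.measurable_δ s hs)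
      (hA.measurable_θ s hs) (hmem s hs)
  have mΦ : ∀ s ≤ N, Measurable fun ω => valueFn f (δ s ω) :=
    fun s hs => (hR.continuousOn_valueFn hG hμ hL12 hU).measurable_comp_of_mem
      (hA.measurable_δ s hs) (hmem s hs)
  have mA : Measurable fun ω => attackEnergy f Δ θstar η c (δ (t + 1) ω) (θ (t + 1) ω) :=
    ((mΦ (t + 1) ht).sub_const _).add ((mW (t + 1) ht).const_mul c)
  have mS : Measurable fun ω => θstar (δ t ω) :=
    (hR.continuousOn_thetaStar hG hμ hL12).measurable_comp_of_mem
      (hA.measurable_δ t ht.le) (hmem t ht.le)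
  have mX : Measurable fun ω => attackProgress θstar γ (δ t ω) (δ (t + 1) ω) (θ t ω) :=
    ((((hA.measurable_δ (t + 1) ht).sub (hA.measurable_δ t ht.le)).norm.pow_const 2).const_mul
      _).add ((((hA.measurable_θ t ht.le).sub mS).norm.pow_const 2).const_mul γ)
  have mu : Measurable fun ω => trackingDirection f θstar η (δ t ω) (θ t ω) :=
    measurable_comp_of_continuousOn_prod (r := trackingDirection f θstar η)
      (hR.continuousOn_trackingDirection hG hμ hL12 hL22 η) (hA.measurable_δ t ht.le)
      (hA.measurable_θ t ht.le) (hmem t ht.le)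
  have mg : Measurable fun ω => gradTheta f (δ t ω) (θ t ω) :=
    measurable_comp_of_continuousOn_prod (r := gradTheta f)
      (hG.continuousOn_gradTheta hL22 hL12) (hA.measurable_δ t ht.le)
      (hA.measurable_θ t ht.le) (hmem t ht.le)
  have me : Measurable fun ω => gθ (δ t ω) (θ t ω) (ξ t ω) - gradTheta f (δ t ω) (θ t ω) :=
    (hSG.measurable_gθ.comp (((hA.measurable_δ t ht.le).prodMk
      (hA.measurable_θ t ht.le)).prodMk (hA.measurable_ξ t ht))).sub mg
  have hA0 : ∀ s ≤ N, ∀ ω, c * ‖θ s ω - θstar (δ s ω)‖ ^ 2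
      ≤ attackEnergy f Δ θstar η c (δ s ω) (θ s ω) := fun s hs ω =>
    hR.mul_sq_le_attackEnergy hG hU hμ hL12 hΔU hΔ hη hc.le (hA.mem hδ₀ hs ω) _
  -- The noise direction grows linearly in the tracking error, so its square is dominated by the
  -- energy, integrable by hypothesis; the other factor has finite variance.
  have hI : Integrable (fun ω => inner ℝ (trackingDirection f θstar η (δ t ω) (θ t ω))
      (gθ (δ t ω) (θ t ω) (ξ t ω) - gradTheta f (δ t ω) (θ t ω))) P := by
    refine Integrable.mono' ((hi.const_mul ((2 * η + 2 * η ^ 2 * L22) ^ 2 / c)).add hn)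
      (mu.inner me).aestronglyMeasurable (Filter.Eventually.of_forall fun ω => ?_)
    have h1 := norm_inner_le_norm (𝕜 := ℝ) (trackingDirection f θstar η (δ t ω) (θ t ω))
      (gθ (δ t ω) (θ t ω) (ξ t ω) - gradTheta f (δ t ω) (θ t ω))
    have h2 := hR.norm_trackingDirection_le hG hη (hmem t ht.le ω) (θ t ω)
    have h3 : ‖trackingDirection f θstar η (δ t ω) (θ t ω)‖ ^ 2
        ≤ (2 * η + 2 * η ^ 2 * L22) ^ 2 / c * attackEnergy f Δ θstar η c (δ t ω) (θ t ω) := by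
      calc _ ≤ ((2 * η + 2 * η ^ 2 * L22) * ‖θ t ω - θstar (δ t ω)‖) ^ 2 := by gcongr
        _ = (2 * η + 2 * η ^ 2 * L22) ^ 2 / c * (c * ‖θ t ω - θstar (δ t ω)‖ ^ 2) := by
          field_simp
        _ ≤ _ := by gcongr; exact hA0 t ht.le ω
    simp only [Pi.add_apply]
    nlinarith [sq_nonneg (‖trackingDirection f θstar η (δ t ω) (θ t ω)‖
      - ‖gθ (δ t ω) (θ t ω) (ξ t ω) - gradTheta f (δ t ω) (θ t ω)‖),
      sq_nonneg ‖gδ (δ t ω) (θ t ω) (ξ t ω) - gradDelta f (δ t ω) (θ t ω)‖,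
      sq_nonneg ‖trackingDirection f θstar η (δ t ω) (θ t ω)‖,
      sq_nonneg ‖gθ (δ t ω) (θ t ω) (ξ t ω) - gradTheta f (δ t ω) (θ t ω)‖]
  have hI0 := hA.integral_inner_noise_eq_zero hSG hG hL12 hL22 hΔU hΔ.isClosed hδ₀
    (hR.continuousOn_trackingDirection hG hμ hL12 hL22 η) ht hI
  have hT := (hi.add (hn.const_mul (γ + k * (2 * η ^ 2)))).add (hI.const_mul k)
  have hle : ∀ ω, attackEnergy f Δ θstar η c (δ (t + 1) ω) (θ (t + 1) ω)
      + attackProgress θstar γ (δ t ω) (δ (t + 1) ω) (θ t ω)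
      ≤ attackEnergy f Δ θstar η c (δ t ω) (θ t ω) + (γ + k * (2 * η ^ 2))
        * (‖gδ (δ t ω) (θ t ω) (ξ t ω) - gradDelta f (δ t ω) (θ t ω)‖ ^ 2
          + ‖gθ (δ t ω) (θ t ω) (ξ t ω) - gradTheta f (δ t ω) (θ t ω)‖ ^ 2)
        + k * inner ℝ (trackingDirection f θstar η (δ t ω) (θ t ω))
          (gθ (δ t ω) (θ t ω) (ξ t ω) - gradTheta f (δ t ω) (θ t ω)) := fun ω => by
    have h1 := hstep t ht ω
    have h2 : 0 ≤ k * (2 * η ^ 2)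
      * ‖gδ (δ t ω) (θ t ω) (ξ t ω) - gradDelta f (δ t ω) (θ t ω)‖ ^ 2 := by positivity
    have h3 : 0 ≤ γ
      * ‖gθ (δ t ω) (θ t ω) (ξ t ω) - gradTheta f (δ t ω) (θ t ω)‖ ^ 2 := by positivity
    unfold attackEnergy attackProgress
    linarith
  have hpos : ∀ ω, 0 ≤ attackEnergy f Δ θstar η c (δ (t + 1) ω) (θ (t + 1) ω) := fun ω =>
    le_trans (by positivity) (hA0 (t + 1) ht ω)
  have hXpos : ∀ ω, 0 ≤ attackProgress θstar γ (δ t ω) (δ (t + 1) ω) (θ t ω) := fun ω =>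
    attackProgress_nonneg θstar hγ.le _ _ _
  have iA : Integrable (fun ω => attackEnergy f Δ θstar η c (δ (t + 1) ω) (θ (t + 1) ω)) P :=
    hT.mono' mA.aestronglyMeasurable (Filter.Eventually.of_forall fun ω => by
      rw [Real.norm_of_nonneg (hpos ω)]
      simp only [Pi.add_apply]
      linarith [hle ω, hXpos ω])
  have iX : Integrable (fun ω => attackProgress θstar γ (δ t ω) (δ (t + 1) ω) (θ t ω)) P :=
    hT.mono' mX.aestronglyMeasurable (Filter.Eventually.of_forall fun ω => by
      rw [Real.norm_of_nonneg (hXpos ω)]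
      simp only [Pi.add_apply]
      linarith [hle ω, hpos ω])
  refine ⟨iA, iX, ?_⟩
  have h1 := integral_mono (iA.add iX) hT hle
  rw [integral_add' iA iX, integral_add' (hi.add (hn.const_mul _)) (hI.const_mul k),
    integral_add' hi (hn.const_mul _), integral_const_mul, integral_const_mul, hI0] at h1
  have h2 := mul_le_mul_of_nonneg_left hnle (by positivity : 0 ≤ γ + k * (2 * η ^ 2))
  linarith

end Run

/-! ### Step size bounds. -/

theorem one_le_Lbar (L12 L22 Φinf : ℝ) : 1 ≤ Lbar L12 L22 Φinf :=
  (le_max_left _ _).trans (le_max_right _ _)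

theorem le_Lbar_left (L12 L22 Φinf : ℝ) : L12 ≤ Lbar L12 L22 Φinf :=
  (le_max_left _ _).trans (le_max_left _ _)

theorem le_Lbar_right (L12 L22 Φinf : ℝ) : L22 ≤ Lbar L12 L22 Φinf :=
  (le_max_right _ _).trans (le_max_left _ _)

theorem two_le_condNum {μ L12 L22 Φinf : ℝ} (hμ : 0 < μ) (hμ1 : μ ≤ 1) :
    2 ≤ condNum μ L12 L22 Φinf := by
  unfold condNum
  rw [le_div_iff₀ (by positivity)]
  have h1 := one_le_Lbar L12 L22 Φinf
  have h2 : μ ^ 2 ≤ 1 := pow_le_one₀ hμ.le hμ1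
  linarith

theorem stepDelta_pos {μ L11 L12 L22 Φinf : ℝ} (hμ : 0 < μ) (hμ1 : μ ≤ 1)
    (hL : 0 < smoothConst μ L11 L12) : 0 < stepDelta μ L11 L12 L22 Φinf := by
  have h1 := one_le_Lbar L12 L22 Φinf
  have h2 := two_le_condNum (L12 := L12) (L22 := L22) (Φinf := Φinf) hμ hμ1
  unfold stepDelta
  exact lt_min (by positivity) (by positivity)

theorem stepDelta_mul_smoothConst_le {μ L11 L12 L22 Φinf : ℝ}
    (hL : 0 < smoothConst μ L11 L12) :
    stepDelta μ L11 L12 L22 Φinf * smoothConst μ L11 L12 ≤ 1 / 32 := by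
  calc _ ≤ 1 / (32 * smoothConst μ L11 L12) * smoothConst μ L11 L12 := by
        gcongr; exact min_le_left _ _
    _ = 1 / 32 := by field_simp

theorem stepDelta_mul_Lbar_le {μ L11 L12 L22 Φinf : ℝ} (hμ : 0 < μ) :
    stepDelta μ L11 L12 L22 Φinf * Lbar L12 L22 Φinf ^ 3 ≤ μ ^ 4 / 32 := by
  have h1 := one_le_Lbar L12 L22 Φinf
  have h2 : stepDelta μ L11 L12 L22 Φinf
      ≤ 1 / (8 * condNum μ L12 L22 Φinf ^ 2 * Lbar L12 L22 Φinf) := min_le_right _ _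
  unfold condNum at h2
  have h3 : 0 < Lbar L12 L22 Φinf := by linarith
  generalize Lbar L12 L22 Φinf = l at *
  calc _ ≤ 1 / (8 * (2 * l / μ ^ 2) ^ 2 * l) * l ^ 3 := by gcongr
    _ = μ ^ 4 / 32 := by
      field_simp
      norm_num

end

/-! ### Error budget and conclusion. -/

theorem attackProgress_ge {n d : ℕ} (θstar : Euc n → Euc d) {γ : ℝ} (hγ : 0 < γ)
    (δ δ' : Euc n) (θ : Euc d) : ‖δ' - δ‖ ^ 2 + ‖θ - θstar δ‖ ^ 2
      ≤ (4 * γ + 1 / γ) * attackProgress θstar γ δ δ' θ := by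
  have h : (4 * γ + 1 / γ) * attackProgress θstar γ δ δ' θ = ‖δ' - δ‖ ^ 2 + ‖θ - θstar δ‖ ^ 2
      + (1 / (4 * γ ^ 2) * ‖δ' - δ‖ ^ 2 + 4 * γ ^ 2 * ‖θ - θstar δ‖ ^ 2) := by
    unfold attackProgress
    field_simp
    ring
  rw [h]
  exact le_add_of_nonneg_right (by positivity)

/-- Conversion of the batch size and iteration count conditions into an error bound. -/
theorem error_budget_le {A k β C a s ε G : ℝ} {N M : ℕ} (hA : 0 < A) (hk : 0 < k)
    (hε : 0 < ε) (hN : 0 < N) (hM : 0 < M)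
    (ha : a ≤ C * G) (hGN : 4 * A * k * C * (G / ε ^ 2) ≤ N)
    (hs : 4 * A * (k * β + 1) * (s / ε ^ 2) ≤ M) :
    ε / 2 + A / ε * (k * (a / N + β * (s / M)) + s / M) ≤ ε := by
  have hN' : (0 : ℝ) < N := by exact_mod_cast hN
  have hM' : (0 : ℝ) < M := by exact_mod_cast hM
  -- The factors 4 give `ε²/4` each to optimization error and noise; dividing the sum by `ε` leaves
  -- `ε/2`.
  have h1 : A * k * (a / N) ≤ ε ^ 2 / 4 := by
    rw [← mul_div_assoc, div_le_iff₀ hN']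
    rw [← mul_div_assoc, div_le_iff₀ (by positivity)] at hGN
    nlinarith [mul_le_mul_of_nonneg_left ha (mul_pos hA hk).le]
  have h2 : A * (k * β + 1) * (s / M) ≤ ε ^ 2 / 4 := by
    rw [← mul_div_assoc, div_le_iff₀ hM']
    rw [← mul_div_assoc, div_le_iff₀ (by positivity)] at hs
    nlinarith
  have h3 : A / ε * (k * (a / N + β * (s / M)) + s / M)
      = (A * k * (a / N) + A * (k * β + 1) * (s / M)) / ε := by
    ring
  have h4 : (A * k * (a / N) + A * (k * β + 1) * (s / M)) / ε ≤ ε / 2 := by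
    rw [div_le_iff₀ hε]
    nlinarith
  linarith


theorem mainTheorem2 (μ L11 L12 L22 Φinf : ℝ)
    (hμ : 0 < μ) (hμ1 : μ ≤ 1) (hL11 : 0 ≤ L11) (hL12 : 0 ≤ L12) (hL22 : 0 < L22)
    (hL : 0 < smoothConst μ L11 L12) :
    -- the constants depend only on `μ, L11, L12, L22, Φinf`
    ∃ CN : ℝ, 0 < CN ∧ ∃ CM : ℝ, 0 < CM ∧
    ∀ (n d : ℕ) (U Δ : Set (Euc n)) (f : Euc n → Euc d → ℝ) (θstar : Euc n → Euc d)
      (δ₀ : Euc n) (θ₀ : Euc d) (D : ℝ),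
      IsOpen U → Δ ⊆ U → Convex ℝ Δ → IsCompact Δ → δ₀ ∈ Δ →
      1 ≤ D → Metric.diam Δ ≤ D → ‖θ₀ - θstar δ₀‖ ≤ D →
      MinimaxRSI f U μ θstar →
      LipschitzGradients f U L11 L12 L22 →
      phiInf f Δ = Φinf →
    ∀ (Ξ : Type*) [MeasurableSpace Ξ] (K : Kernel (Euc n × Euc d) Ξ) [IsMarkovKernel K]
      (gδ : Euc n → Euc d → Ξ → Euc n) (gθ : Euc n → Euc d → Ξ → Euc d)
      (σ ε : ℝ) (M N : ℕ),
      0 < ε → ε < 1 → 0 < M →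
      StochasticGradients f Δ K gδ gθ σ M →
      CN * (((8 * condNum μ L12 L22 Φinf ^ 2 + 32) * Lbar L12 L22 Φinf * valueGap f Δ δ₀
          + condNum μ L12 L22 Φinf * D ^ 2 * Lbar L12 L22 Φinf ^ 2) / ε ^ 2) ≤ (N : ℝ) →
      CM * (σ ^ 2 * condNum μ L12 L22 Φinf / ε ^ 2) ≤ (M : ℝ) →
    ∀ (Ω : Type*) [MeasurableSpace Ω] (P : Measure Ω) [IsProbabilityMeasure P]
      (ξ : ℕ → Ω → Ξ) (δ : ℕ → Ω → Euc n) (θ : ℕ → Ω → Euc d),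
      IsPersistentAttack P Δ K gδ gθ (stepTheta μ L22) (stepDelta μ L11 L12 L22 Φinf)
        δ₀ θ₀ N ξ δ θ →
      ∃ t < N, Integrable (fun ω => fospResidual f Δ (δ t ω) (θ t ω)) P ∧
        ∫ ω, fospResidual f Δ (δ t ω) (θ t ω) ∂P ≤ ε := by
  obtain ⟨γ, hγd⟩ : ∃ γ, γ = stepDelta μ L11 L12 L22 Φinf := ⟨_, rfl⟩
  obtain ⟨Lb, hLbd⟩ : ∃ Lb, Lb = Lbar L12 L22 Φinf := ⟨_, rfl⟩
  obtain ⟨κ, hκd⟩ : ∃ κ, κ = condNum μ L12 L22 Φinf := ⟨_, rfl⟩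
  obtain ⟨η, hηd⟩ : ∃ η, η = stepTheta μ L22 := ⟨_, rfl⟩
  have hη' : η = μ / L22 := hηd
  have hγ : 0 < γ := hγd ▸ stepDelta_pos hμ hμ1 hL
  have hγL : γ * smoothConst μ L11 L12 ≤ 1 / 32 := hγd ▸ stepDelta_mul_smoothConst_le hL
  have hγκ : γ * Lb ^ 3 ≤ μ ^ 4 / 32 := by rw [hγd, hLbd]; exact stepDelta_mul_Lbar_le hμ
  have hLb : 1 ≤ Lb := hLbd ▸ one_le_Lbar _ _ _
  have h12 : L12 ≤ Lb := hLbd ▸ le_Lbar_left _ _ _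
  have h22 : L22 ≤ Lb := hLbd ▸ le_Lbar_right _ _ _
  have hκ : 2 ≤ κ := hκd ▸ two_le_condNum hμ hμ1
  have hη : 0 < η := by rw [hη']; positivity
  have hηL : η * L22 ≤ 1 := by rw [hη', div_mul_cancel₀ _ hL22.ne']; exact hμ1
  rw [← hγd, ← hLbd, ← hκd, ← hηd]
  obtain ⟨c, hcd⟩ : ∃ c, c = 2 * γ * Lb ^ 2 / (η * μ) := ⟨_, rfl⟩
  have hc : 0 < c := by rw [hcd]; positivity
  obtain ⟨A, hAd⟩ : ∃ A, A = 3 / 2 * (1 / γ + Φinf + 1 + L22) ^ 2 + L12 + 1 := ⟨_, rfl⟩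
  have hA0 : 0 < A := by rw [hAd]; positivity
  obtain ⟨k, hkd⟩ : ∃ k, k = 4 * γ + 1 / γ := ⟨_, rfl⟩
  have hk : 0 < k := by rw [hkd]; positivity
  obtain ⟨c₁, hc₁d⟩ : ∃ c₁, c₁ = c * (1 + η * μ / 2) := ⟨_, rfl⟩
  have hc₁ : 0 < c₁ := by rw [hc₁d]; positivity
  obtain ⟨β, hβd⟩ : ∃ β, β = γ + c₁ * (2 * η ^ 2) := ⟨_, rfl⟩
  have hβ : 0 < β := by rw [hβd]; positivity
  -- `A` converts squares into the residual, `k` converts energy surplus into squares, `1 + 2c`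
  -- bounds the initial energy, and `β` is the noise cost per step; the extra 1 is the noise in the
  -- residual bound itself. All are fixed before the problem is chosen.
  refine ⟨4 * A * k * (1 + 2 * c), by positivity, 4 * A * (k * β + 1), by positivity, ?_⟩
  intro n d U Δ f θstar δ₀ θ₀ D hU hΔU hΔ hΔc hδ₀ hD _ hD₀ hR hG hΦ Ξ _ K _ gδ gθ σ ε M N
    hε hε1 hM hSG hNle hMle Ω _ P _ ξ δ θ hA
  have hgap : 0 ≤ valueGap f Δ δ₀ := sub_nonneg.2 <|
    csInf_le (hΔc.bddBelow_image ((hR.continuousOn_valueFn hG hμ hL12 hU).mono hΔU))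
      (Set.mem_image_of_mem (valueFn f) hδ₀)
  -- The weights in the iteration bound are used only through being at least 1.
  have hG1 : valueGap f Δ δ₀ + D ^ 2 ≤ (8 * κ ^ 2 + 32) * Lb * valueGap f Δ δ₀
      + κ * D ^ 2 * Lb ^ 2 := by
    have e1 : 1 ≤ (8 * κ ^ 2 + 32) * Lb := one_le_mul_of_one_le_of_one_le (by nlinarith) hLb
    have e2 : 1 ≤ κ * Lb ^ 2 := one_le_mul_of_one_le_of_one_le (by linarith) (one_le_pow₀ hLb)
    linarith [mul_le_mul_of_nonneg_right e1 hgap, mul_le_mul_of_nonneg_right e2 (sq_nonneg D)]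
  have hNle' : 4 * A * k * (1 + 2 * c) * ((valueGap f Δ δ₀ + D ^ 2) / ε ^ 2) ≤ N :=
    le_trans (by gcongr) hNle
  have hN : 0 < N := by
    have : (0 : ℝ) < N := lt_of_lt_of_le (by positivity) hNle'
    exact_mod_cast this
  have hMle' : 4 * A * (k * β + 1) * (σ ^ 2 / ε ^ 2) ≤ M :=
    le_trans (by gcongr; exact le_mul_of_one_le_right (sq_nonneg σ) (by linarith)) hMle
  have hstep : ∀ t < N, ∀ ω, valueFn f (δ (t + 1) ω)
        + c * trackingEnergy f θstar η (δ (t + 1) ω) (θ (t + 1) ω)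
        + 1 / (4 * γ) * ‖δ (t + 1) ω - δ t ω‖ ^ 2 + γ * ‖θ t ω - θstar (δ t ω)‖ ^ 2
      ≤ valueFn f (δ t ω) + c * trackingEnergy f θstar η (δ t ω) (θ t ω)
        + γ * ‖gδ (δ t ω) (θ t ω) (ξ t ω) - gradDelta f (δ t ω) (θ t ω)‖ ^ 2
        + c₁ * inner ℝ (trackingDirection f θstar η (δ t ω) (θ t ω))
          (gθ (δ t ω) (θ t ω) (ξ t ω) - gradTheta f (δ t ω) (θ t ω))
        + c₁ * (2 * η ^ 2) * ‖gθ (δ t ω) (θ t ω) (ξ t ω) - gradTheta f (δ t ω) (θ t ω)‖ ^ 2 := by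
    intro t ht ω
    rw [hA.step_θ t ht ω, hc₁d]
    exact hR.energy_step hG hU hμ hμ1 hL11 hL12 hL22 hΔU hΔ hLb h12 h22 hγ hγL hγκ hη' hcd
      (hA.mem hδ₀ ht.le ω) (hA.step_δ t ht ω) (θ t ω) _
  have hexp := fun (t : ℕ) (ht : t < N) => hA.energy_expectation_step hSG hR hG hU hμ hL11 hL12
    hL22.le hΔU hΔc hδ₀ hη.le hγ hc hc₁.le hstep ht
  have hstart : ∀ ω, attackEnergy f Δ θstar η c (δ 0 ω) (θ 0 ω)
      = attackEnergy f Δ θstar η c δ₀ θ₀ := fun ω => by rw [hA.init_δ, hA.init_θ]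
  -- Integrability propagates from the deterministic start, since each energy is dominated by the
  -- previous one plus integrable noise terms.
  have hint : ∀ t ≤ N, Integrable (fun ω => attackEnergy f Δ θstar η c (δ t ω) (θ t ω)) P := by
    intro t
    induction t with
    | zero =>
      intro _
      simp only [hstart]
      exact integrable_const _
    | succ t ih => exact fun ht => (hexp t ht (ih (Nat.le_of_succ_le ht))).1
  have hpos : 0 ≤ ∫ ω, attackEnergy f Δ θstar η c (δ N ω) (θ N ω) ∂P :=
    integral_nonneg fun ω => le_trans (by positivity) (hR.mul_sq_le_attackEnergy hG hU hμ hL12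
      hΔU hΔc hη.le hc.le (hA.mem hδ₀ le_rfl ω) (θ N ω))
  obtain ⟨t, ht, hle⟩ := exists_lt_le_of_telescoping hN
    (a := fun t => ∫ ω, attackEnergy f Δ θstar η c (δ t ω) (θ t ω) ∂P)
    (x := fun t => ∫ ω, attackProgress θstar γ (δ t ω) (δ (t + 1) ω) (θ t ω) ∂P)
    (b := β * (σ ^ 2 / M)) hpos
    (fun t ht => hβd ▸ (hexp t ht (hint t ht.le)).2.2)
  simp only [hstart, integral_const, probReal_univ, one_smul] at hle
  have ha : attackEnergy f Δ θstar η c δ₀ θ₀ ≤ (1 + 2 * c) * (valueGap f Δ δ₀ + D ^ 2) := by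
    have h1 := hR.trackingEnergy_le hG hU hη.le hηL (hΔU hδ₀) θ₀
    have h2 : ‖θ₀ - θstar δ₀‖ ^ 2 ≤ D ^ 2 := by gcongr
    have h3 := mul_le_mul_of_nonneg_left (h1.trans (mul_le_mul_of_nonneg_left h2 zero_le_two))
      hc.le
    have h4 : attackEnergy f Δ θstar η c δ₀ θ₀
        = valueGap f Δ δ₀ + c * trackingEnergy f θstar η δ₀ θ₀ := rfl
    rw [h4]
    linarith [mul_nonneg hc.le hgap, sq_nonneg D]
  obtain ⟨hn, hnle⟩ := hA.integral_noise_le hSG hG hL11 hL12 hL22.le hΔU hΔc.isClosed hδ₀ ht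
  have hX := (hexp t ht (hint t ht.le)).2.1
  have hbound : ∀ ω, fospResidual f Δ (δ t ω) (θ t ω) ≤ ε / 2 + A / ε
      * (k * attackProgress θstar γ (δ t ω) (δ (t + 1) ω) (θ t ω)
        + (‖gδ (δ t ω) (θ t ω) (ξ t ω) - gradDelta f (δ t ω) (θ t ω)‖ ^ 2
          + ‖gθ (δ t ω) (θ t ω) (ξ t ω) - gradTheta f (δ t ω) (θ t ω)‖ ^ 2)) := fun ω => by
    have hδ := hA.mem hδ₀ ht.le ω
    have h1 := hR.fospResidual_le hG hΔU hΔ hγ hL12 hL22.le hε hε1.le hδ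
      (hΦ ▸ hR.norm_gradDelta_thetaStar_le hG hμ hL11 hL12 hU hΔU hΔc hδ)
      (hA.step_δ t ht ω) (θ t ω)
    rw [← hAd] at h1
    refine h1.trans ?_
    have h2 := attackProgress_ge θstar hγ (δ t ω) (δ (t + 1) ω) (θ t ω)
    rw [← hkd] at h2
    have h3 := sq_nonneg ‖gθ (δ t ω) (θ t ω) (ξ t ω) - gradTheta f (δ t ω) (θ t ω)‖
    gcongr
    linarith
  have hdom := (integrable_const (μ := P) (ε / 2)).add
    (((hX.const_mul k).add hn).const_mul (A / ε))
  have hr : Integrable (fun ω => fospResidual f Δ (δ t ω) (θ t ω)) P :=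
    hdom.mono' (hG.measurable_fospResidual hL11 hL12 hL22.le hΔU hΔ (hA.measurable_δ t ht.le)
      (hA.measurable_θ t ht.le) (hA.mem hδ₀ ht.le)).aestronglyMeasurable
      (Filter.Eventually.of_forall fun ω => by
        rw [Real.norm_of_nonneg (fospResidual_nonneg _ _ _ _)]
        exact hbound ω)
  refine ⟨t, ht, hr, ?_⟩
  have h1 := integral_mono hr hdom hbound
  rw [integral_add' (integrable_const _) (((hX.const_mul k).add hn).const_mul (A / ε)),
    integral_const_mul, integral_add' (hX.const_mul k) hn, integral_const_mul, integral_const,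
    probReal_univ, one_smul] at h1
  refine h1.trans (le_trans ?_ (error_budget_le hA0 hk hε hN hM ha hNle' hMle'))
  gcongr
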